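/- **Setting.** Let $d\in\{2,3\}$, let $\Omega\subset\mathbb{R}^d$ be a simply connected, bounded, polygonal/polyhedral Lipschitz domain with boundary $\Gamma$ and exterior unit normal $n$, and let $m,q>0$, $0<B\le 1$. Let $\mathbf{S}$ be the space of symmetric real $d\times d$ matrices with the Frobenius inner product $A:C$ and norm $|A|$, and let $T\in L_\infty(\Omega;\mathbf{S})$. Write $(\cdot,\cdot)$ and $\|\cdot\|$ for the $L_2(\Omega)$ inner product and norm (of scalar or tensor functions), $\nabla\nabla v$ for the weak Hessian, $\operatorname{div}\mathbf{div}\,M=\sum_{i,j}\partial_i\partial_jM_{ij}$ (weakly), and $H(\operatorname{div}\mathbf{div},\Omega;\mathbf{S})=\{M\in L_2(\Omega;\mathbf{S}):\operatorname{div}\mathbf{div}\,M\in L_2(\Omega)\}$. The boundary is decomposed as $\Gamma=\mathrm{closure}\bigl(\Gamma_{hc}\cup\Gamma_{ss}\cup\Gamma_{sc}\cup\Gamma_f\cup\bigcup_{\gamma\in J_D\cup J_N}\gamma\bigr)$, where $\Gamma_{hc},\Gamma_{ss},\Gamma_{sc},\Gamma_f$ are pairwise disjoint, possibly empty, relatively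 open subsets of $\Gamma$, and $J_D,J_N$ are disjoint, possibly empty, finite sets of vertex-singletons $\gamma$ (if $d=2$, at angles that may be $\pi$) or relatively open straight edges $\gamma$ shared by two faces (if $d=3$); these $\gamma$ are pairwise disjoint, disjoint from the four pieces, and each has positive distance to $\Gamma_{hc}\cup\Gamma_{ss}$. Set $$\|v\|_{\mathrm{Ggrad}}^2=m\|v\|^2+B\|\nabla\nabla v+q^2Tv\|^2\qquad(v\in H^2(\Omega)),$$ $$\langle M,N\rangle_{\mathrm{divdiv}}=B(M,N)+\tfrac{B^2}{m}\bigl(\operatorname{div}\mathbf{div}\,M+q^2T:M,\ \operatorname{div}\mathbf{div}\,N+q^2T:N\bigr),\qquad \|M\|_{\mathrm{divdiv}}^2=\langle M,M\rangle_{\mathrm{divdiv}},$$ and, for $v\in H^2(\Omega)$ and $M\in H(\operatorname{div}\mathbf{div},\Omega;\mathbf{S})$, $$\langle\mathrm{tr}^{\mathrm{Ggrad}}(v),M\rangle=\langle\mathrm{tr}^{\mathrm{dDiv}}(M),v\rangle=(\operatorname{div}\mathbf{div}\,M,v)-(M,\nabla\nabla v).$$ Let $$H^2_D(\Omega)=\{v\in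 H^2(\Omega): v|_{\Gamma_{hc}\cup\Gamma_{ss}}=0,\ n\cdot\nabla v|_{\Gamma_{hc}\cup\Gamma_{sc}}=0,\ v|_\gamma=0\ \forall\gamma\in J_D\},$$ $$H_N=\{M\in H(\operatorname{div}\mathbf{div},\Omega;\mathbf{S}):\langle\mathrm{tr}^{\mathrm{dDiv}}(M),v\rangle=0\ \forall v\in H^2_D(\Omega)\}.$$ **Theorem.** Let $f\in L_2(\Omega)$, $G\in H(\operatorname{div}\mathbf{div},\Omega;\mathbf{S})$ and $g\in H^2(\Omega)$. There is a unique $M\in H(\operatorname{div}\mathbf{div},\Omega;\mathbf{S})$ with $$\langle M,\delta M\rangle_{\mathrm{divdiv}}=\tfrac Bm\bigl(f,\operatorname{div}\mathbf{div}\,\delta M+q^2T:\delta M\bigr)-B\langle\mathrm{tr}^{\mathrm{Ggrad}}(g),\delta M\rangle\quad\forall\,\delta M\in H_N,$$ $$\langle\mathrm{tr}^{\mathrm{dDiv}}(M),\delta u\rangle=\langle\mathrm{tr}^{\mathrm{dDiv}}(G),\delta u\rangle\quad\forall\,\delta u\in H^2_D(\Omega),$$ and it satisfies $$\|M\|_{\mathrm{divdiv}}\le\tfrac1{\sqrt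 m}\|f\|+2\|G\|_{\mathrm{divdiv}}+\|g\|_{\mathrm{Ggrad}}.$$ Moreover, $u:=\frac1m f-\frac Bm(\operatorname{div}\mathbf{div}\,M+q^2T:M)$ belongs to $H^2(\Omega)$, satisfies $M=\nabla\nabla u+q^2Tu$ and the boundary conditions $$\langle\mathrm{tr}^{\mathrm{Ggrad}}(u),\delta M\rangle=\langle\mathrm{tr}^{\mathrm{Ggrad}}(g),\delta M\rangle\ \ \forall\,\delta M\in H_N,\qquad \langle\mathrm{tr}^{\mathrm{dDiv}}(\nabla\nabla u+q^2Tu),\delta u\rangle=\langle\mathrm{tr}^{\mathrm{dDiv}}(G),\delta u\rangle\ \ \forall\,\delta u\in H^2_D(\Omega),$$ and is the unique minimizer of $$v\mapsto\frac B2\int_\Omega|\nabla\nabla v+q^2Tv|^2+\frac m2\int_\Omega v^2-\int_\Omega fv+B\langle\mathrm{tr}^{\mathrm{dDiv}}(G),v\rangle$$ over $V_g=\{v\in H^2(\Omega):\langle\mathrm{tr}^{\mathrm{Ggrad}}(v),\delta M\rangle=\langle\mathrm{tr}^{\mathrm{Ggrad}}(g),\delta M\rangle\ \forall\,\delta M\in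 H_N\}$. Finally, $$\|u\|_{\mathrm{Ggrad}}\le\tfrac3{\sqrt m}\|f\|+3\|G\|_{\mathrm{divdiv}}+2\|g\|_{\mathrm{Ggrad}},$$ $$\|u\|\le\tfrac1m\|f\|+\tfrac Bm\|\operatorname{div}\mathbf{div}\,M+q^2T:M\|\le\tfrac1m\|f\|+\tfrac1{\sqrt m}\|M\|_{\mathrm{divdiv}}.$$ -/

import Mathlib

open MeasureTheory Filter Topology
open scoped ENNReal ContDiff

namespace Smectic

noncomputable section

/-! ### Euclidean space, symmetric tensors, Lebesgue spaces -/

/-- `ℝ^d` with the Euclidean norm. -/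
abbrev Sp (d : ℕ) : Type := EuclideanSpace ℝ (Fin d)

/-- The space `𝐒` of symmetric real `d × d` matrices, a subspace of `ℝ^(d × d)` with the Euclidean
structure of the latter. Hence the inner product is the Frobenius product
`A : B = ∑ i j, A i j * B i j`, and the norm is the Frobenius norm. -/
def SymT (d : ℕ) : Submodule ℝ (EuclideanSpace ℝ (Fin d × Fin d)) where
  carrier := {A | ∀ i j, A (i, j) = A (j, i)}
  zero_mem' := by intro i j; simp
  add_mem' := by
    intro A B hA hB i j
    simp [hA i j, hB i j]
  smul_mem' := by
    intro c A hA i j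
    simp [hA i j]

/-- The entry `(i, j)` of a symmetric tensor. -/
def entry {d : ℕ} (A : SymT d) (i j : Fin d) : ℝ := (A : EuclideanSpace ℝ (Fin d × Fin d)) (i, j)

/-- `L₂(Ω)`. -/
abbrev L2 {d : ℕ} (Ω : Set (Sp d)) : Type := Lp ℝ 2 (volume.restrict Ω)

/-- `L₂(Ω; ℝ^d)`. -/
abbrev L2V {d : ℕ} (Ω : Set (Sp d)) : Type := Lp (Sp d) 2 (volume.restrict Ω)

/-- `L₂(Ω; 𝐒)`. -/
abbrev L2S {d : ℕ} (Ω : Set (Sp d)) : Type := Lp (SymT d) 2 (volume.restrict Ω)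

/-- `L_∞(Ω; 𝐒)`. -/
abbrev LinfS {d : ℕ} (Ω : Set (Sp d)) : Type := Lp (SymT d) ∞ (volume.restrict Ω)

/-- The pointwise Frobenius product `T : M ∈ L₂(Ω)` of `T ∈ L_∞(Ω; 𝐒)` and `M ∈ L₂(Ω; 𝐒)`. -/
def frob {d : ℕ} {Ω : Set (Sp d)} (T : LinfS Ω) (M : L2S Ω) : L2 Ω :=
  (innerSL ℝ : SymT d →L[ℝ] SymT d →L[ℝ] ℝ).holder 2 T M

/-- The pointwise product `T v ∈ L₂(Ω; 𝐒)` of `T ∈ L_∞(Ω; 𝐒)` and a scalar `v ∈ L₂(Ω)`. -/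
def tmul {d : ℕ} {Ω : Set (Sp d)} (T : LinfS Ω) (v : L2 Ω) : L2S Ω :=
  (ContinuousLinearMap.lsmul ℝ ℝ : ℝ →L[ℝ] SymT d →L[ℝ] SymT d).flip.holder 2 T v

/-! ### Weak derivatives -/

/-- The classical partial derivative `∂_i φ`. -/
def pd {d : ℕ} (i : Fin d) (φ : Sp d → ℝ) : Sp d → ℝ :=
  fun x => fderiv ℝ φ x (EuclideanSpace.single i 1)

/-- Test functions: `φ ∈ C_0^∞(Ω)`. -/
def IsTest {d : ℕ} (Ω : Set (Sp d)) (φ : Sp d → ℝ) : Prop :=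
  ContDiff ℝ ∞ φ ∧ HasCompactSupport φ ∧ tsupport φ ⊆ Ω

/-- `p` is the weak gradient of `v` on `Ω`. -/
def HasWeakGrad {d : ℕ} {Ω : Set (Sp d)} (v : L2 Ω) (p : L2V Ω) : Prop :=
  ∀ φ : Sp d → ℝ, IsTest Ω φ → ∀ i : Fin d,
    ∫ x in Ω, v x * pd i φ x = - ∫ x in Ω, p x i * φ x

/-- `H` is the weak Hessian `∇∇v` of `v` on `Ω`. -/
def HasWeakHess {d : ℕ} {Ω : Set (Sp d)} (v : L2 Ω) (H : L2S Ω) : Prop :=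
  ∀ φ : Sp d → ℝ, IsTest Ω φ → ∀ i j : Fin d,
    ∫ x in Ω, v x * pd i (pd j φ) x = ∫ x in Ω, entry (H x) i j * φ x

/-- `w` is the iterated weak divergence `div div M = ∑ i j, ∂_i ∂_j M_ij` of `M` on `Ω`. -/
def HasWeakDivDiv {d : ℕ} {Ω : Set (Sp d)} (M : L2S Ω) (w : L2 Ω) : Prop :=
  ∀ φ : Sp d → ℝ, IsTest Ω φ →
    ∫ x in Ω, (∑ i, ∑ j, entry (M x) i j * pd i (pd j φ) x) = ∫ x in Ω, w x * φ x

/-- The Sobolev space `H²(Ω)`: all weak derivatives of order at most two are in `L₂`. -/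
def H2 {d : ℕ} (Ω : Set (Sp d)) : Set (L2 Ω) :=
  {v | (∃ p, HasWeakGrad v p) ∧ ∃ H, HasWeakHess v H}

/-- The space `H(div div, Ω; 𝐒)`. -/
def HdivDiv {d : ℕ} (Ω : Set (Sp d)) : Set (L2S Ω) :=
  {M | ∃ w, HasWeakDivDiv M w}

open Classical in
/-- The weak Hessian as an element of `L₂(Ω; 𝐒)` (zero if there is none). -/
def hess {d : ℕ} {Ω : Set (Sp d)} (v : L2 Ω) : L2S Ω :=
  if h : ∃ H, HasWeakHess v H then h.choose else 0

open Classical in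
/-- The iterated weak divergence as an element of `L₂(Ω)` (zero if there is none). -/
def divDiv {d : ℕ} {Ω : Set (Sp d)} (M : L2S Ω) : L2 Ω :=
  if h : ∃ w, HasWeakDivDiv M w then h.choose else 0

/-! ### Polygonal and polyhedral Lipschitz domains -/

/-- Near every boundary point, `Ω` is the strict epigraph, in some direction `e`, of a Lipschitz
function on the hyperplane orthogonal to `e`. -/
def IsLipschitzSet {d : ℕ} (Ω : Set (Sp d)) : Prop :=
  ∀ x ∈ frontier Ω, ∃ (e : Sp d) (K : NNReal) (η : Sp d → ℝ), ‖e‖ = 1 ∧ LipschitzWith K η ∧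
    ∀ᶠ y in 𝓝 x, y ∈ Ω ↔ η (y - inner ℝ e y • e) < inner ℝ e y

/-- The closure of `Ω` is a finite union of convex polytopes. -/
def IsPolyhedralSet {d : ℕ} (Ω : Set (Sp d)) : Prop :=
  ∃ P : Set (Set (Sp d)), P.Finite ∧ (∀ s ∈ P, s.Finite) ∧ closure Ω = ⋃ s ∈ P, convexHull ℝ s

/-- Simply connected, bounded, polygonal/polyhedral Lipschitz domains. -/
structure IsAdmissibleDomain {d : ℕ} (Ω : Set (Sp d)) : Prop where
  isOpen : IsOpen Ω
  bounded : Bornology.IsBounded Ω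
  simplyConnected : IsSimplyConnected Ω
  lipschitz : IsLipschitzSet Ω
  polyhedral : IsPolyhedralSet Ω

/-- The surface measure on `Γ = ∂Ω` (the `(d-1)`-dimensional Hausdorff measure, up to the
normalising constant). -/
def surf {d : ℕ} (Ω : Set (Sp d)) : Measure (Sp d) :=
  (Measure.hausdorffMeasure ((d : ℝ) - 1)).restrict (frontier Ω)

/-- `n` is the exterior unit normal vector of the polyhedral domain `Ω` at the boundary point `x`:
near `x`, `Ω` is the half space `{y | n ⬝ (y - x) < 0}`. -/
def IsExteriorNormal {d : ℕ} (Ω : Set (Sp d)) (x n : Sp d) : Prop :=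
  x ∈ frontier Ω ∧ ‖n‖ = 1 ∧ ∀ᶠ y in 𝓝 x, y ∈ Ω ↔ inner ℝ n (y - x) < 0

/-- `S` is relatively open in `Γ = ∂Ω`. -/
def IsRelOpen {d : ℕ} (Ω S : Set (Sp d)) : Prop :=
  ∃ U, IsOpen U ∧ S = U ∩ frontier Ω

/-- A face of `Γ` (an edge of the polygon, if `d = 2`): a non-empty, connected, relatively open
subset of `Γ` that lies in a hyperplane. -/
def IsFace {d : ℕ} (Ω F : Set (Sp d)) : Prop :=
  IsConnected F ∧ IsRelOpen Ω F ∧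
    ∃ (n : Sp d) (c : ℝ), n ≠ 0 ∧ ∀ x ∈ F, inner ℝ n x = c

/-- A vertex-singleton where two edges of the polygon `Γ` meet (`d = 2`, at an angle that may
be `π`), or a relatively open, straight edge that is shared by two faces of `Γ` (`d = 3`). -/
def IsVertexOrEdge {d : ℕ} (Ω γ : Set (Sp d)) : Prop :=
  (∃ F₁ F₂, IsFace Ω F₁ ∧ IsFace Ω F₂ ∧ Disjoint F₁ F₂ ∧ γ ⊆ closure F₁ ∩ closure F₂) ∧
    ((d = 2 ∧ ∃ x, γ = {x}) ∨ (d = 3 ∧ ∃ x y, x ≠ y ∧ γ = openSegment ℝ x y))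

/-- The decomposition of `Γ = ∂Ω` into hard clamped, simply supported, soft clamped and free
relatively open pieces (which may be empty; a non-empty relatively open piece is a union of
connected relatively open sets, of positive measure), and into two sets `JD`, `JN` of
vertex-singletons or edges. -/
structure BoundaryDecomposition {d : ℕ} (Ω : Set (Sp d)) where
  hc : Set (Sp d)
  ss : Set (Sp d)
  sc : Set (Sp d)
  fr : Set (Sp d)
  JD : Set (Set (Sp d))
  JN : Set (Set (Sp d))
  hc_open : IsRelOpen Ω hc
  ss_open : IsRelOpen Ω ss
  sc_open : IsRelOpen Ω sc
  fr_open : IsRelOpen Ω fr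
  pieces_disjoint : [hc, ss, sc, fr].Pairwise Disjoint
  J_finite : (JD ∪ JN).Finite
  J_vertexOrEdge : ∀ γ ∈ JD ∪ JN, IsVertexOrEdge Ω γ
  JD_JN_disjoint : Disjoint JD JN
  J_disjoint : (JD ∪ JN).PairwiseDisjoint id
  J_pieces_disjoint : ∀ γ ∈ JD ∪ JN, Disjoint γ (hc ∪ ss ∪ sc ∪ fr)
  cover : frontier Ω = closure (hc ∪ ss ∪ sc ∪ fr ∪ ⋃₀ (JD ∪ JN))
  J_dist : ∀ γ ∈ JD ∪ JN, ∃ δ > 0, ∀ x ∈ γ, ∀ y ∈ hc ∪ ss, δ ≤ dist x y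

/-- `w ∈ L₂(Γ)` is the trace on `Γ` of `v ∈ H¹(Ω)`, that is, the limit in `L₂(Γ)` of the
restrictions to `Γ` of smooth functions that converge to `v` in `H¹(Ω)`. -/
def HasTrace {d : ℕ} (Ω : Set (Sp d)) (v w : Sp d → ℝ) : Prop :=
  MemLp w 2 (surf Ω) ∧ ∃ (φ : ℕ → Sp d → ℝ) (p : L2V Ω), (∀ k, ContDiff ℝ ∞ (φ k)) ∧
    Tendsto (fun k => eLpNorm (fun x => φ k x - v x) 2 (volume.restrict Ω)) atTop (𝓝 0) ∧
    (∀ i, Tendsto (fun k => eLpNorm (fun x => pd i (φ k) x - p x i) 2 (volume.restrict Ω))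
      atTop (𝓝 0)) ∧
    Tendsto (fun k => eLpNorm (fun x => φ k x - w x) 2 (surf Ω)) atTop (𝓝 0)

/-- The space `H²_D(Ω)` of all `v ∈ H²(Ω)` with `v = 0` on `Γ_hc ∪ Γ_ss` and `n ⬝ ∇v = 0` on
`Γ_hc ∪ Γ_sc` in the sense of traces, and with `v = 0` on every `γ ∈ J_D` for the
representative of `v` that is continuous on the closure of `Ω`. -/
def H2D {d : ℕ} {Ω : Set (Sp d)} (Γ : BoundaryDecomposition Ω) : Set (L2 Ω) :=
  {v | v ∈ H2 Ω ∧
    (∃ w, HasTrace Ω v w ∧ ∀ᵐ x ∂(surf Ω), x ∈ Γ.hc ∪ Γ.ss → w x = 0) ∧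
    (∃ (p : L2V Ω) (W : Fin d → Sp d → ℝ), HasWeakGrad v p ∧
      (∀ i, HasTrace Ω (fun x => p x i) (W i)) ∧
      ∀ᵐ x ∂(surf Ω), x ∈ Γ.hc ∪ Γ.sc → ∀ n, IsExteriorNormal Ω x n → ∑ i, n i * W i x = 0) ∧
    ∃ z : Sp d → ℝ, ContinuousOn z (closure Ω) ∧ z =ᵐ[volume.restrict Ω] v ∧
      ∀ γ ∈ Γ.JD, ∀ x ∈ γ, z x = 0}

/-! ### Norms, trace operators and the variational problem -/

section Problem

variable {d : ℕ} {Ω : Set (Sp d)}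

/-- The norm `‖v‖_Ggrad` of `H²(Ω)`. -/
def normGgrad (m q B : ℝ) (T : LinfS Ω) (v : L2 Ω) : ℝ :=
  Real.sqrt (m * ‖v‖ ^ 2 + B * ‖hess v + q ^ 2 • tmul T v‖ ^ 2)

/-- The operator `div div M + q² T : M`. -/
def divDivT (q : ℝ) (T : LinfS Ω) (M : L2S Ω) : L2 Ω :=
  divDiv M + q ^ 2 • frob T M

/-- The inner product of `H(div div, Ω; 𝐒)`. -/
def innerDivDiv (m q B : ℝ) (T : LinfS Ω) (M N : L2S Ω) : ℝ :=
  B * inner ℝ M N + B ^ 2 / m * inner ℝ (divDivT q T M) (divDivT q T N)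

/-- The norm `‖M‖_divdiv` of `H(div div, Ω; 𝐒)`. -/
def normDivDiv (m q B : ℝ) (T : LinfS Ω) (M : L2S Ω) : ℝ :=
  Real.sqrt (innerDivDiv m q B T M M)

/-- The trace functional `⟨tr^Ggrad(v), M⟩` of `v ∈ H²(Ω)`. -/
def trGgrad (v : L2 Ω) (M : L2S Ω) : ℝ :=
  inner ℝ (divDiv M) v - inner ℝ M (hess v)

/-- The trace functional `⟨tr^divDiv(M), v⟩` of `M ∈ H(div div, Ω; 𝐒)`. -/
def trDivDiv (M : L2S Ω) (v : L2 Ω) : ℝ :=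
  inner ℝ (divDiv M) v - inner ℝ M (hess v)

/-- The space `H_N(div div, Ω; 𝐒)`. -/
def HNdivDiv (Γ : BoundaryDecomposition Ω) : Set (L2S Ω) :=
  {M | M ∈ HdivDiv Ω ∧ ∀ v ∈ H2D Γ, trDivDiv M v = 0}

/-- `u` satisfies the boundary condition `⟨tr^Ggrad(u), δM⟩ = ⟨tr^Ggrad(g), δM⟩` for all
`δM ∈ H_N(div div, Ω; 𝐒)`. -/
def BCu (Γ : BoundaryDecomposition Ω) (g u : L2 Ω) : Prop :=
  ∀ N ∈ HNdivDiv Γ, trGgrad u N = trGgrad g N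

/-- `M` satisfies the boundary condition `⟨tr^divDiv(M), δu⟩ = ⟨tr^divDiv(G), δu⟩` for all
`δu ∈ H²_D(Ω)`. -/
def BCM (Γ : BoundaryDecomposition Ω) (G M : L2S Ω) : Prop :=
  ∀ v ∈ H2D Γ, trDivDiv M v = trDivDiv G v

/-- The affine space `V_g`. -/
def Vg (Γ : BoundaryDecomposition Ω) (g : L2 Ω) : Set (L2 Ω) :=
  {v | v ∈ H2 Ω ∧ BCu Γ g v}

/-- The energy
`B/2 ∫ |∇∇v + q² T v|² + m/2 ∫ v² - ∫ f v + B ⟨tr^divDiv(G), v⟩`. -/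
def energy (m q B : ℝ) (T : LinfS Ω) (f : L2 Ω) (G : L2S Ω) (v : L2 Ω) : ℝ :=
  B / 2 * (∫ x in Ω, ‖(hess v + q ^ 2 • tmul T v) x‖ ^ 2) + m / 2 * (∫ x in Ω, v x ^ 2)
    - (∫ x in Ω, f x * v x) + B * trDivDiv G v

/-- `u = argmin_{v ∈ V_g}` of the energy: `u ∈ V_g` is the one and only minimiser. -/
def IsArgmin (m q B : ℝ) (T : LinfS Ω) (Γ : BoundaryDecomposition Ω) (f : L2 Ω) (G : L2S Ω)
    (g u : L2 Ω) : Prop :=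
  u ∈ Vg Γ g ∧ (∀ v ∈ Vg Γ g, energy m q B T f G u ≤ energy m q B T f G v) ∧
    ∀ v ∈ Vg Γ g, energy m q B T f G v ≤ energy m q B T f G u → v = u

/-- `M` solves the variational problem: `M ∈ H(div div, Ω; 𝐒)`,
`⟨M, δM⟩_divdiv = (B/m) (f, div div δM + q² T : δM) - B ⟨tr^Ggrad(g), δM⟩` for all
`δM ∈ H_N(div div, Ω; 𝐒)`, and `⟨tr^divDiv(M), δu⟩ = ⟨tr^divDiv(G), δu⟩` for all
`δu ∈ H²_D(Ω)`. -/
def IsSolution (m q B : ℝ) (T : LinfS Ω) (Γ : BoundaryDecomposition Ω) (f : L2 Ω) (G : L2S Ω)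
    (g : L2 Ω) (M : L2S Ω) : Prop :=
  M ∈ HdivDiv Ω ∧
    (∀ N ∈ HNdivDiv Γ,
      innerDivDiv m q B T M N = B / m * inner ℝ f (divDivT q T N) - B * trGgrad g N) ∧
    BCM Γ G M

/-- The postprocessed function `u = f/m - (B/m) (div div M + q² T : M)`. -/
def postU (m q B : ℝ) (T : LinfS Ω) (f : L2 Ω) (M : L2S Ω) : L2 Ω :=
  (1 / m) • f - (B / m) • divDivT q T M

end Problem

end

end Smectic

open Smectic

namespace Smectic

noncomputable section

/-! ### Test functions -/

section TestFunctions

variable {d : ℕ} {Ω : Set (Sp d)} {φ ψ : Sp d → ℝ}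

/-! The problem is an orthogonal projection in the Hilbert space L₂(Ω;𝐒) × L₂(Ω). The map `hat`
sends M to (√B M, (B/√m)(div div M + q² T:M)), an isometry for the divdiv product, and `chk` sends v
to (-√B(∇∇v + q² T v), √m v), of norm ‖v‖_Ggrad. Since T: and T· are adjoint, ⟨hat N, chk v⟩ is B
times the trace functional (`inner_hat_chk`), so boundary conditions become orthogonality relations.

Hence H_N is identified with the orthogonal complement of the `chk`-images of H²_D and of the test
functions. Test functions add no constraint on H(div div), and orthogonality to them forces an
arbitrary pair to be some `hat N` (`exists_hat_eq`). So H_N is complete, and `isSolution_iff` makes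
M the projection of `load` onto the affine space `hat G` + `hatHN`: existence, uniqueness and the
bound on M follow. Of H²_D only the inclusion in H² is needed; no trace theorem enters.

Testing with compactly supported single-entry tensors shows that u has weak Hessian M - q² T u.
Membership in H² also needs a weak gradient in L₂. On a bounded Lipschitz set it follows from the
weak Hessian (`HasWeakHess.exists_hasWeakGrad`): translations along interior cones and a
one-dimensional interpolation inequality bound v ↦ ∫ v ∂_i φ by ‖φ‖, and Riesz representation gives
the gradient.

With M = ∇∇u + q² T u known, the boundary condition for u is the variational equation reread, the
energy is an exact quadratic around u (`IsSolution.energy_eq`), and `chk u` = (0, f/√m) - `hat M`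
yields the bound in the Ggrad norm. -/

lemma IsTest.continuous (h : IsTest Ω φ) : Continuous φ := h.1.continuous

lemma IsTest.differentiable (h : IsTest Ω φ) : Differentiable ℝ φ :=
  h.1.differentiable (by simp)

lemma IsTest.eq_zero_of_notMem (h : IsTest Ω φ) {x : Sp d} (hx : x ∉ Ω) : φ x = 0 := by
  by_contra h0
  exact hx (h.2.2 (subset_tsupport φ h0))

lemma IsTest.of_tsupport_subset (h : IsTest Ω φ) (hψ : ContDiff ℝ ∞ ψ)
    (hs : tsupport ψ ⊆ tsupport φ) : IsTest Ω ψ :=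
  ⟨hψ, h.2.1.of_isClosed_subset (isClosed_tsupport ψ) hs, hs.trans h.2.2⟩

lemma isTest_zero : IsTest Ω (0 : Sp d → ℝ) :=
  ⟨contDiff_const, HasCompactSupport.zero, by simp [tsupport]⟩

lemma IsTest.add (h : IsTest Ω φ) (h' : IsTest Ω ψ) : IsTest Ω (φ + ψ) :=
  ⟨h.1.add h'.1, h.2.1.add h'.2.1, (tsupport_add φ ψ).trans (Set.union_subset h.2.2 h'.2.2)⟩

lemma IsTest.const_smul (h : IsTest Ω φ) (c : ℝ) : IsTest Ω (c • φ) :=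
  h.of_tsupport_subset (h.1.const_smul c) (closure_mono (Function.support_const_smul_subset c φ))

lemma IsTest.mul_left (h : IsTest Ω φ) (hψ : ContDiff ℝ ∞ ψ) : IsTest Ω (fun x => ψ x * φ x) :=
  h.of_tsupport_subset (hψ.mul h.1) (closure_mono (Function.support_mul_subset_right ψ φ))

/-- The derivative of `φ` in the direction `ξ`. -/
def dirDeriv (ξ : Sp d) (φ : Sp d → ℝ) : Sp d → ℝ := fun x => fderiv ℝ φ x ξ

lemma IsTest.dirDeriv (h : IsTest Ω φ) (ξ : Sp d) : IsTest Ω (dirDeriv ξ φ) := by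
  refine h.of_tsupport_subset ((h.1.fderiv_right (m := ∞) (by simp)).clm_apply contDiff_const) ?_
  refine closure_minimal (fun x hx => ?_) (isClosed_tsupport φ)
  refine tsupport_fderiv_subset ℝ (subset_tsupport _ ?_)
  intro h0
  exact hx (by simp [Smectic.dirDeriv, h0])

lemma IsTest.pd (h : IsTest Ω φ) (i : Fin d) : IsTest Ω (pd i φ) := h.dirDeriv _

lemma IsTest.pd_pd (h : IsTest Ω φ) (i j : Fin d) :
    IsTest Ω (Smectic.pd i (Smectic.pd j φ)) := (h.pd j).pd i

lemma pd_comm (hφ : ContDiff ℝ ∞ φ) (i j : Fin d) : pd i (pd j φ) = pd j (pd i φ) := by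
  funext x
  have hd : DifferentiableAt ℝ (fderiv ℝ φ) x :=
    ((hφ.fderiv_right (m := ∞) (by simp)).differentiable (by simp)) x
  have key : ∀ ξ η : Sp d, fderiv ℝ (fun y => fderiv ℝ φ y ξ) x η
      = fderiv ℝ (fderiv ℝ φ) x η ξ := by
    intro ξ η
    rw [fderiv_clm_apply hd (by fun_prop)]
    simp
  unfold pd
  rw [key, key]
  exact (hφ.contDiffAt.isSymmSndFDerivAt (by
    simpa using WithTop.coe_le_coe.2 (le_top : (2 : ℕ∞) ≤ ⊤))) _ _

lemma dirDeriv_eq_sum_pd (ξ : Sp d) (φ : Sp d → ℝ) :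
    dirDeriv ξ φ = fun x => ∑ i, ξ i * pd i φ x := by
  funext x
  have hξ : ξ = ∑ i, ξ i • EuclideanSpace.single i (1 : ℝ) := by
    ext k
    simp [Finset.sum_apply, Pi.single_apply]
  conv_lhs => rw [dirDeriv, hξ]
  simp [pd]

lemma dirDeriv_dirDeriv_eq_sum_pd (hφ : ContDiff ℝ ∞ φ) (ξ : Sp d) :
    dirDeriv ξ (dirDeriv ξ φ) = fun x => ∑ i, ∑ j, ξ i * ξ j * pd i (pd j φ) x := by
  rw [dirDeriv_eq_sum_pd ξ (dirDeriv ξ φ)]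
  funext x
  refine Finset.sum_congr rfl fun i _ => ?_
  have hj : ∀ j : Fin d, DifferentiableAt ℝ (pd j φ) x := fun j =>
    (((hφ.fderiv_right (m := ∞) (by simp)).clm_apply contDiff_const).differentiable (by simp)) x
  have h1 : pd i (dirDeriv ξ φ) x = ∑ j, ξ j * pd i (pd j φ) x := by
    rw [dirDeriv_eq_sum_pd]
    unfold pd at hj ⊢
    rw [fderiv_fun_sum (fun j _ => (hj j).const_mul _)]
    simp only [_root_.sum_apply]
    refine Finset.sum_congr rfl fun j _ => ?_
    rw [fderiv_const_mul (hj j)]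
    simp
  rw [h1, Finset.mul_sum]
  exact Finset.sum_congr rfl fun j _ => by ring

lemma IsTest.memLp (h : IsTest Ω φ) (p : ℝ≥0∞) (μ : Measure (Sp d))
    [IsFiniteMeasureOnCompacts μ] : MemLp φ p μ :=
  h.continuous.memLp_of_hasCompactSupport h.2.1

/-- Both integrands vanish off Ω, so this is integration by parts on the whole space, without any
regularity of the boundary. -/
lemma IsTest.setIntegral_mul_pd (hφ : IsTest Ω φ) (hψ : IsTest Ω ψ) (i : Fin d) :
    ∫ x in Ω, φ x * Smectic.pd i ψ x = - ∫ x in Ω, Smectic.pd i φ x * ψ x := by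
  rw [setIntegral_eq_integral_of_forall_compl_eq_zero
      (fun x hx => by rw [hφ.eq_zero_of_notMem hx, zero_mul]),
    setIntegral_eq_integral_of_forall_compl_eq_zero
      (fun x hx => by rw [hψ.eq_zero_of_notMem hx, mul_zero])]
  refine integral_mul_fderiv_eq_neg_fderiv_mul_of_integrable
    (f := φ) (g := ψ) ?_ ?_ ?_ (fun x _ => hφ.differentiable x) (fun x _ => hψ.differentiable x)
  · exact ((hφ.pd i).memLp 2 _).integrable_mul (hψ.memLp 2 _)
  · exact (hφ.memLp 2 _).integrable_mul ((hψ.pd i).memLp 2 _)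
  · exact (hφ.memLp 2 _).integrable_mul (hψ.memLp 2 _)

lemma IsTest.setIntegral_mul_pd_pd (hφ : IsTest Ω φ) (hψ : IsTest Ω ψ) (i j : Fin d) :
    ∫ x in Ω, φ x * Smectic.pd i (Smectic.pd j ψ) x
      = ∫ x in Ω, Smectic.pd i (Smectic.pd j φ) x * ψ x := by
  rw [hφ.setIntegral_mul_pd (hψ.pd j) i, (hφ.pd i).setIntegral_mul_pd hψ j, neg_neg,
    pd_comm hφ.1]

/-- The class of a test function in `L₂(Ω)`. -/
def IsTest.toL2 (h : IsTest Ω φ) : L2 Ω := (h.memLp 2 (volume.restrict Ω)).toLp φ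

lemma IsTest.inner_toL2 (h : IsTest Ω φ) (v : L2 Ω) :
    inner ℝ v h.toL2 = ∫ x in Ω, v x * φ x := by
  rw [L2.inner_def]
  refine integral_congr_ae ?_
  filter_upwards [(h.memLp 2 (volume.restrict Ω)).coeFn_toLp] with x hx
  rw [IsTest.toL2, hx]
  simp [mul_comm]

lemma integrable_mul_isTest (v : L2 Ω) (h : IsTest Ω φ) :
    Integrable (fun x => v x * φ x) (volume.restrict Ω) :=
  (Lp.memLp v).integrable_mul (h.memLp 2 _)

lemma eq_zero_of_forall_isTest (hΩ : IsOpen Ω) {f : Sp d → ℝ}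
    (hf : MemLp f 2 (volume.restrict Ω))
    (h : ∀ φ, IsTest Ω φ → ∫ x in Ω, f x * φ x = 0) : f =ᵐ[volume.restrict Ω] 0 := by
  have key := hΩ.ae_eq_zero_of_integral_contDiff_smul_eq_zero (f := f) (μ := volume) ?_ ?_
  · exact (ae_restrict_iff' hΩ.measurableSet).2 key
  · exact locallyIntegrableOn_of_locallyIntegrable_restrict (hf.locallyIntegrable (by norm_num))
  · intro g hg hc hs
    rw [← h g ⟨hg, hc, hs⟩, setIntegral_eq_integral_of_forall_compl_eq_zero]
    · simp [mul_comm]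
    · intro x hx
      rw [IsTest.eq_zero_of_notMem ⟨hg, hc, hs⟩ hx, mul_zero]

end TestFunctions

/-! ### Symmetric tensors -/

section Tensors

variable {d : ℕ} {Ω : Set (Sp d)}

/-- The symmetric part of a matrix. -/
def symPart (a : Fin d → Fin d → ℝ) : SymT d :=
  ⟨WithLp.toLp 2 fun k => (a k.1 k.2 + a k.2 k.1) / 2, fun i j => by simp [add_comm]⟩

lemma entry_comm (A : SymT d) (i j : Fin d) : entry A i j = entry A j i := A.2 i j

lemma inner_eq_sum_entry (A C : SymT d) : inner ℝ A C = ∑ i, ∑ j, entry A i j * entry C i j := by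
  rw [Submodule.coe_inner, PiLp.inner_apply, Fintype.sum_prod_type]
  simp [entry, mul_comm]

lemma entry_symPart (a : Fin d → Fin d → ℝ) (i j : Fin d) :
    entry (symPart a) i j = (a i j + a j i) / 2 := rfl

/-- A symmetric tensor does not see antisymmetric parts, so arbitrary matrices of test functions can
be paired with it. -/
lemma inner_symPart (A : SymT d) (a : Fin d → Fin d → ℝ) :
    inner ℝ A (symPart a) = ∑ i, ∑ j, entry A i j * a i j := by
  rw [inner_eq_sum_entry]
  have h : ∑ i, ∑ j, entry A i j * a j i = ∑ i, ∑ j, entry A i j * a i j := by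
    rw [Finset.sum_comm]
    exact Finset.sum_congr rfl fun i _ => Finset.sum_congr rfl fun j _ => by rw [entry_comm]
  have h2 : ∑ i, ∑ j, entry A i j * entry (symPart a) i j
      = (∑ i, ∑ j, entry A i j * a i j + ∑ i, ∑ j, entry A i j * a j i) / 2 := by
    simp only [entry_symPart, ← Finset.sum_add_distrib, Finset.sum_div]
    exact Finset.sum_congr rfl fun i _ => Finset.sum_congr rfl fun j _ => by ring
  rw [h2, h]
  ring

lemma ext_entry {A C : SymT d} (h : ∀ i j, entry A i j = entry C i j) : A = C := by
  apply Subtype.ext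
  ext ⟨i, j⟩
  exact h i j

/-- The entry `(i, j)` as a continuous linear functional. -/
def entryCLM (i j : Fin d) : SymT d →L[ℝ] ℝ :=
  (EuclideanSpace.proj (i, j) : EuclideanSpace ℝ (Fin d × Fin d) →L[ℝ] ℝ).comp
    (SymT d).subtypeL

lemma memLp_entry (M : L2S Ω) (i j : Fin d) :
    MemLp (fun x => entry (M x) i j) 2 (volume.restrict Ω) :=
  (entryCLM i j).comp_memLp' (Lp.memLp M)

/-- The tensor field that consists of the symmetric parts of a matrix of scalar fields. -/
def symField (a : Fin d → Fin d → Sp d → ℝ) : Sp d → SymT d := fun x => symPart fun i j => a i j x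

lemma memLp_symField {a : Fin d → Fin d → Sp d → ℝ} (h : ∀ i j, IsTest Ω (a i j)) :
    MemLp (symField a) 2 (volume.restrict Ω) := by
  have hc : Continuous (symField a) := by
    refine Continuous.subtype_mk ?_ _
    refine (PiLp.continuous_toLp 2 _).comp ?_
    refine continuous_pi fun k => ?_
    exact ((h _ _).continuous.add (h _ _).continuous).div_const 2
  refine hc.memLp_of_hasCompactSupport ?_
  have hK : IsCompact (⋃ i, ⋃ j, tsupport (a i j)) :=
    isCompact_iUnion fun i => isCompact_iUnion fun j => (h i j).2.1
  refine HasCompactSupport.intro hK fun x hx => ?_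
  have h0 : ∀ i j, a i j x = 0 := by
    intro i j
    simp only [Set.mem_iUnion, not_exists] at hx
    exact image_eq_zero_of_notMem_tsupport (hx i j)
  refine ext_entry fun i j => ?_
  change (a i j x + a j i x) / 2 = 0
  simp [h0]

/-- The class in `L₂(Ω; 𝐒)` of the symmetric part of a matrix of test functions. -/
def toL2S {a : Fin d → Fin d → Sp d → ℝ} (h : ∀ i j, IsTest Ω (a i j)) : L2S Ω :=
  (memLp_symField h).toLp _

lemma coeFn_toL2S {a : Fin d → Fin d → Sp d → ℝ} (h : ∀ i j, IsTest Ω (a i j)) :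
    toL2S h =ᵐ[volume.restrict Ω] symField a := (memLp_symField h).coeFn_toLp

lemma inner_toL2S {a : Fin d → Fin d → Sp d → ℝ} (h : ∀ i j, IsTest Ω (a i j)) (M : L2S Ω) :
    inner ℝ M (toL2S h) = ∫ x in Ω, ∑ i, ∑ j, entry (M x) i j * a i j x := by
  rw [L2.inner_def]
  refine integral_congr_ae ?_
  filter_upwards [coeFn_toL2S h] with x hx
  rw [hx]
  exact inner_symPart _ _

lemma integrable_entry_mul (M : L2S Ω) {φ : Sp d → ℝ} (h : IsTest Ω φ) (i j : Fin d) :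
    Integrable (fun x => entry (M x) i j * φ x) (volume.restrict Ω) :=
  (memLp_entry M i j).integrable_mul (h.memLp 2 _)

end Tensors

/-! ### Uniqueness of weak derivatives -/

section Weak

variable {d : ℕ} {Ω : Set (Sp d)}

lemma HasWeakHess.unique (hΩ : IsOpen Ω) {v : L2 Ω} {H H' : L2S Ω} (h : HasWeakHess v H)
    (h' : HasWeakHess v H') : H = H' := by
  have key : ∀ i j, ∀ᵐ x ∂(volume.restrict Ω), entry (H x) i j = entry (H' x) i j := by
    intro i j
    have := eq_zero_of_forall_isTest hΩ ((memLp_entry H i j).sub (memLp_entry H' i j)) ?_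
    · filter_upwards [this] with x hx
      simpa [sub_eq_zero] using hx
    · intro φ hφ
      simp only [Pi.sub_apply, sub_mul]
      rw [integral_sub (integrable_entry_mul H hφ i j) (integrable_entry_mul H' hφ i j),
        ← h φ hφ i j, ← h' φ hφ i j, sub_self]
  apply Lp.ext
  filter_upwards [ae_all_iff.2 fun i => ae_all_iff.2 (key i)] with x hx
  exact ext_entry hx

lemma HasWeakDivDiv.unique (hΩ : IsOpen Ω) {M : L2S Ω} {w w' : L2 Ω} (h : HasWeakDivDiv M w)
    (h' : HasWeakDivDiv M w') : w = w' := by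
  have := eq_zero_of_forall_isTest hΩ ((Lp.memLp w).sub (Lp.memLp w')) ?_
  · apply Lp.ext
    filter_upwards [this] with x hx
    simpa [sub_eq_zero] using hx
  · intro φ hφ
    simp only [Pi.sub_apply, sub_mul]
    rw [integral_sub (integrable_mul_isTest w hφ) (integrable_mul_isTest w' hφ), ← h φ hφ, ← h' φ hφ, sub_self]

lemma HasWeakHess.hess_eq (hΩ : IsOpen Ω) {v : L2 Ω} {H : L2S Ω} (h : HasWeakHess v H) :
    hess v = H := by
  have he : ∃ H, HasWeakHess v H := ⟨H, h⟩
  rw [hess, dif_pos he]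
  exact he.choose_spec.unique hΩ h

lemma HasWeakDivDiv.divDiv_eq (hΩ : IsOpen Ω) {M : L2S Ω} {w : L2 Ω} (h : HasWeakDivDiv M w) :
    divDiv M = w := by
  have he : ∃ w, HasWeakDivDiv M w := ⟨w, h⟩
  rw [divDiv, dif_pos he]
  exact he.choose_spec.unique hΩ h

lemma hasWeakHess_hess {v : L2 Ω} (h : ∃ H, HasWeakHess v H) : HasWeakHess v (hess v) := by
  rw [hess, dif_pos h]
  exact h.choose_spec

lemma hasWeakDivDiv_divDiv {M : L2S Ω} (h : M ∈ HdivDiv Ω) : HasWeakDivDiv M (divDiv M) := by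
  have he : ∃ w, HasWeakDivDiv M w := h
  rw [divDiv, dif_pos he]
  exact he.choose_spec

/-- Rewrites the weak divergence as Hilbert space relations, from which linearity is immediate and
which can be compared with orthogonality to `chk` of test functions. -/
lemma hasWeakDivDiv_iff {M : L2S Ω} {w : L2 Ω} :
    HasWeakDivDiv M w ↔
      ∀ φ, ∀ h : IsTest Ω φ, inner ℝ M (toL2S h.pd_pd) = inner ℝ w h.toL2 := by
  refine forall_congr' fun φ => forall_congr' fun h => ?_
  rw [inner_toL2S, h.inner_toL2]

lemma IsTest.hasWeakHess {φ : Sp d → ℝ} (h : IsTest Ω φ) :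
    HasWeakHess h.toL2 (toL2S h.pd_pd) := by
  intro ψ hψ i j
  have e1 : ∫ x in Ω, h.toL2 x * Smectic.pd i (Smectic.pd j ψ) x
      = ∫ x in Ω, φ x * Smectic.pd i (Smectic.pd j ψ) x := by
    refine integral_congr_ae ?_
    filter_upwards [(h.memLp 2 (volume.restrict Ω)).coeFn_toLp] with x hx
    rw [IsTest.toL2, hx]
  rw [e1, h.setIntegral_mul_pd_pd hψ]
  refine integral_congr_ae ?_
  filter_upwards [coeFn_toL2S h.pd_pd] with x hx
  rw [hx]
  simp only [symField, entry_symPart]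
  rw [pd_comm h.1 j i]
  ring

lemma HasWeakHess.add {v v' : L2 Ω} {H H' : L2S Ω} (h : HasWeakHess v H)
    (h' : HasWeakHess v' H') : HasWeakHess (v + v') (H + H') := by
  intro φ hφ i j
  have e1 : ∫ x in Ω, (v + v') x * pd i (pd j φ) x
      = ∫ x in Ω, v x * pd i (pd j φ) x + v' x * pd i (pd j φ) x := by
    refine integral_congr_ae ?_
    filter_upwards [Lp.coeFn_add v v'] with x hx
    rw [hx, Pi.add_apply, add_mul]
  have e2 : ∫ x in Ω, entry ((H + H') x) i j * φ x
      = ∫ x in Ω, entry (H x) i j * φ x + entry (H' x) i j * φ x := by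
    refine integral_congr_ae ?_
    filter_upwards [Lp.coeFn_add H H'] with x hx
    rw [hx, ← add_mul]
    rfl
  rw [e1, e2, integral_add (integrable_mul_isTest v (hφ.pd_pd i j))
    (integrable_mul_isTest v' (hφ.pd_pd i j)),
    integral_add (integrable_entry_mul H hφ i j) (integrable_entry_mul H' hφ i j),
    h φ hφ i j, h' φ hφ i j]

lemma HasWeakHess.const_smul {v : L2 Ω} {H : L2S Ω} (h : HasWeakHess v H) (c : ℝ) :
    HasWeakHess (c • v) (c • H) := by
  intro φ hφ i j
  have e1 : ∫ x in Ω, (c • v) x * pd i (pd j φ) x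
      = ∫ x in Ω, c * (v x * pd i (pd j φ) x) := by
    refine integral_congr_ae ?_
    filter_upwards [Lp.coeFn_smul c v] with x hx
    rw [hx, Pi.smul_apply, smul_eq_mul, mul_assoc]
  have e2 : ∫ x in Ω, entry ((c • H) x) i j * φ x
      = ∫ x in Ω, c * (entry (H x) i j * φ x) := by
    refine integral_congr_ae ?_
    filter_upwards [Lp.coeFn_smul c H] with x hx
    rw [hx, ← mul_assoc]
    rfl
  rw [e1, e2, integral_const_mul, integral_const_mul, h φ hφ i j]

lemma HasWeakDivDiv.add {M M' : L2S Ω} {w w' : L2 Ω} (h : HasWeakDivDiv M w)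
    (h' : HasWeakDivDiv M' w') : HasWeakDivDiv (M + M') (w + w') := by
  rw [hasWeakDivDiv_iff] at *
  intro φ hφ
  rw [inner_add_left (𝕜 := ℝ) M M', inner_add_left, h φ hφ, h' φ hφ]

lemma HasWeakDivDiv.const_smul {M : L2S Ω} {w : L2 Ω} (h : HasWeakDivDiv M w) (c : ℝ) :
    HasWeakDivDiv (c • M) (c • w) := by
  rw [hasWeakDivDiv_iff] at *
  intro φ hφ
  rw [real_inner_smul_left M, real_inner_smul_left, h φ hφ]

end Weak

/-! ### Products with `L_∞` tensors -/

section Products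

variable {d : ℕ} {Ω : Set (Sp d)}

/-- This adjointness lets the zero-order terms with T cancel in the trace functional. -/
lemma inner_frob (T : LinfS Ω) (M : L2S Ω) (v : L2 Ω) :
    inner ℝ (frob T M) v = inner ℝ M (tmul T v) := by
  rw [L2.inner_def, L2.inner_def]
  refine integral_congr_ae ?_
  filter_upwards [ContinuousLinearMap.coeFn_holder (r := 2)
      (innerSL ℝ : SymT d →L[ℝ] SymT d →L[ℝ] ℝ) T M,
    ContinuousLinearMap.coeFn_holder (r := 2)
      (ContinuousLinearMap.lsmul ℝ ℝ : ℝ →L[ℝ] SymT d →L[ℝ] SymT d).flip T v] with x h1 h2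
  rw [frob, tmul, h1, h2]
  change v x * inner ℝ (T x) (M x) = inner ℝ (M x) (v x • T x)
  rw [real_inner_smul_right (M x) (T x), real_inner_comm (M x) (T x)]

lemma tmul_add (T : LinfS Ω) (v v' : L2 Ω) : tmul T (v + v') = tmul T v + tmul T v' :=
  ContinuousLinearMap.holder_add_right _ _ _ _

lemma tmul_smul (T : LinfS Ω) (c : ℝ) (v : L2 Ω) : tmul T (c • v) = c • tmul T v :=
  ContinuousLinearMap.holder_smul_right _ _ _ _

lemma frob_add (T : LinfS Ω) (M N : L2S Ω) : frob T (M + N) = frob T M + frob T N :=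
  ContinuousLinearMap.holder_add_right _ _ _ _

lemma frob_smul (T : LinfS Ω) (c : ℝ) (M : L2S Ω) : frob T (c • M) = c • frob T M :=
  ContinuousLinearMap.holder_smul_right _ _ _ _

end Products

end

end Smectic
-- From a weak Hessian in L₂ to a weak gradient in L₂.
namespace Smectic

noncomputable section

/-- A linear functional that is bounded by the norm of a linear map into a Hilbert space is
represented by an element of that space. -/
lemma exists_inner_eq_of_abs_le {V E : Type*} [AddCommGroup V] [Module ℝ V]
    [NormedAddCommGroup E] [InnerProductSpace ℝ E] [CompleteSpace E] (J : V →ₗ[ℝ] E)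
    (L : V →ₗ[ℝ] ℝ) (C : ℝ) (h : ∀ v, |L v| ≤ C * ‖J v‖) : ∃ p : E, ∀ v, L v = inner ℝ p (J v) := by
  -- The bound makes L vanish on the kernel of J, so L descends to the range. The range need not be
  -- closed: Hahn–Banach extends the bounded functional to E before Riesz is applied.
  have hker : LinearMap.ker J ≤ LinearMap.ker L := by
    intro v hv
    have := h v
    rw [LinearMap.mem_ker.1 hv, norm_zero, mul_zero] at this
    exact abs_nonpos_iff.1 this
  let L' : LinearMap.range J →ₗ[ℝ] ℝ :=
    ((LinearMap.ker J).liftQ L hker).comp J.quotKerEquivRange.symm.toLinearMap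
  have hL' : ∀ v, L' ⟨J v, LinearMap.mem_range_self J v⟩ = L v := by
    intro v
    have : J.quotKerEquivRange.symm ⟨J v, LinearMap.mem_range_self J v⟩
        = (LinearMap.ker J).mkQ v := by
      rw [LinearEquiv.symm_apply_eq]
      rfl
    simp [L', this]
  let F : LinearMap.range J →L[ℝ] ℝ := L'.mkContinuous C (by
    rintro ⟨_, v, rfl⟩
    rw [hL', Real.norm_eq_abs]
    exact h v)
  obtain ⟨F', hF', -⟩ := exists_extension_norm_eq (LinearMap.range J) F
  refine ⟨(InnerProductSpace.toDual ℝ E).symm F', fun v => ?_⟩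
  rw [InnerProductSpace.toDual_symm_apply, ← hL']
  exact (hF' ⟨J v, LinearMap.mem_range_self J v⟩).symm

/-- Interpolation: at a mean value point c the slope is at most 2A/h, and f' varies by at most hB
between 0 and c. -/
lemma exists_deriv_bound {f f' f'' : ℝ → ℝ} {h A B : ℝ} (hh : 0 < h)
    (hf : ∀ s, HasDerivAt f (f' s) s) (hf' : ∀ s, HasDerivAt f' (f'' s) s)
    (hA : ∀ s ∈ Set.Icc 0 h, |f s| ≤ A) (hB : ∀ s ∈ Set.Icc 0 h, |f'' s| ≤ B) :
    |f' 0| ≤ 2 / h * A + h * B := by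
  obtain ⟨c, hc, hfc⟩ := exists_hasDerivAt_eq_slope f f' hh
    (fun s _ => (hf s).continuousAt.continuousWithinAt) (fun s _ => hf s)
  have hB0 : 0 ≤ B := (abs_nonneg _).trans (hB 0 ⟨le_rfl, hh.le⟩)
  have h1 : |f' c| ≤ 2 / h * A := by
    rw [hfc, sub_zero, abs_div, abs_of_pos hh, div_mul_eq_mul_div]
    gcongr
    calc |f h - f 0| ≤ |f h| + |f 0| := abs_sub _ _
      _ ≤ 2 * A := by linarith [hA h ⟨hh.le, le_rfl⟩, hA 0 ⟨le_rfl, hh.le⟩]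
  have h2 : ‖f' c - f' 0‖ ≤ B * ‖c - 0‖ :=
    (convex_Icc 0 h).norm_image_sub_le_of_norm_hasDerivWithin_le
      (fun s _ => (hf' s).hasDerivWithinAt) hB ⟨le_rfl, hh.le⟩ ⟨hc.1.le, hc.2.le⟩
  rw [sub_zero, Real.norm_eq_abs, Real.norm_eq_abs, abs_of_pos hc.1] at h2
  have h3 : B * c ≤ h * B := by nlinarith [hc.2]
  have h4 : |f' 0| ≤ |f' c| + |f' c - f' 0| := by
    have := abs_sub (f' c) (f' c - f' 0)
    rwa [sub_sub_cancel] at this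
  linarith

section Interior

variable {d : ℕ} {Ω : Set (Sp d)} {φ : Sp d → ℝ}

/-- Near every point of its closure, a Lipschitz set is mapped into itself by small translations
in the directions of some open cone. -/
lemma IsLipschitzSet.exists_cone (hΩ : IsOpen Ω) (hL : IsLipschitzSet Ω) {x : Sp d}
    (hx : x ∈ closure Ω) : ∃ (U : Set (Sp d)) (e : Sp d) (δ h : ℝ), IsOpen U ∧ x ∈ U ∧ 0 < δ ∧
      0 < h ∧ ∀ w : Sp d, ‖w‖ ≤ 1 → ∀ y ∈ U ∩ Ω, ∀ s ∈ Set.Icc 0 h, y + s • (e + δ • w) ∈ Ω := by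
  by_cases hxΩ : x ∈ Ω
  · obtain ⟨r, hr, hball⟩ := Metric.isOpen_iff.1 hΩ x hxΩ
    -- At an interior point every direction is admissible, so the cone is a full ball around the
    -- axis e = 0.
    refine ⟨Metric.ball x (r / 2), 0, 1, r / 2, Metric.isOpen_ball,
      Metric.mem_ball_self (by positivity), one_pos, by positivity, ?_⟩
    intro w hw y hy s hs
    apply hball
    rw [Metric.mem_ball, dist_eq_norm]
    have h1 : ‖y - x‖ < r / 2 := by simpa [dist_eq_norm] using hy.1
    have h2 : ‖s • (0 + (1 : ℝ) • w)‖ ≤ r / 2 := by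
      rw [zero_add, one_smul, norm_smul, Real.norm_eq_abs, abs_of_nonneg hs.1]
      nlinarith [hs.1, hs.2, norm_nonneg w]
    calc ‖y + s • (0 + (1 : ℝ) • w) - x‖ = ‖(y - x) + s • (0 + (1 : ℝ) • w)‖ := by congr 1; abel
      _ ≤ _ := norm_add_le _ _
      _ < r := by linarith
  · obtain ⟨e, K, η, he, hη, hev⟩ := hL x (by
      rw [frontier, hΩ.interior_eq]
      exact ⟨hx, hxΩ⟩)
    obtain ⟨r, hr, hball⟩ := Metric.eventually_nhds_iff_ball.1 hev
    have hK : (0 : ℝ) ≤ K := K.2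
    -- A step s(e + δw) raises the height by at least s(1 - δ), while the graph η rises by at most
    -- 2Kδs. This δ is the one with 2Kδ = 1 - δ.
    set δ : ℝ := 1 / (2 * K + 1) with hδ
    have hδ0 : 0 < δ := by positivity
    have hδ1 : δ ≤ 1 := by
      rw [hδ, div_le_one (by positivity)]
      linarith
    have hKδ : K * (2 * δ) ≤ 1 - δ := by
      have : δ * (2 * K + 1) = 1 := by
        rw [hδ]
        field_simp
      linarith
    -- As ‖e + δw‖ ≤ 2, steps up to r/8 move a point by at most r/4 and keep it in the ball of
    -- radius r, where the epigraph description holds.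
    refine ⟨Metric.ball x (r / 2), e, δ, r / 8, Metric.isOpen_ball,
      Metric.mem_ball_self (by positivity), hδ0, by positivity, ?_⟩
    intro w hw y hy s hs
    have h1 : ‖y - x‖ < r / 2 := by simpa [dist_eq_norm] using hy.1
    have hs0 := hs.1
    have hew : ‖e + δ • w‖ ≤ 2 := by
      calc ‖e + δ • w‖ ≤ ‖e‖ + ‖δ • w‖ := norm_add_le _ _
        _ ≤ 2 := by
          rw [he, norm_smul, Real.norm_eq_abs, abs_of_pos hδ0]
          nlinarith [norm_nonneg w]
    have hmem : y + s • (e + δ • w) ∈ Metric.ball x r := by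
      rw [Metric.mem_ball, dist_eq_norm]
      calc ‖y + s • (e + δ • w) - x‖ = ‖(y - x) + s • (e + δ • w)‖ := by congr 1; abel
        _ ≤ ‖y - x‖ + ‖s • (e + δ • w)‖ := norm_add_le _ _
        _ < r := by
          rw [norm_smul, Real.norm_eq_abs, abs_of_nonneg hs0]
          nlinarith [hs.2, norm_nonneg (e + δ • w)]
    have hymem : y ∈ Metric.ball x r := Metric.ball_subset_ball (by linarith) hy.1
    have hyη := (hball y hymem).1 hy.2
    rw [hball _ hmem]
    set t : ℝ := inner ℝ e w with ht
    have hee : (inner ℝ e e : ℝ) = 1 := by rw [real_inner_self_eq_norm_sq, he]; norm_num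
    have ht1 : |t| ≤ 1 := by
      have := abs_real_inner_le_norm e w
      rw [he, one_mul] at this
      exact this.trans hw
    have hin : (inner ℝ e (y + s • (e + δ • w)) : ℝ) = inner ℝ e y + s * (1 + δ * t) := by
      rw [inner_add_right, real_inner_smul_right, inner_add_right, real_inner_smul_right, hee]
    have hpt : y + s • (e + δ • w) - (inner ℝ e (y + s • (e + δ • w)) : ℝ) • e
        = (y - (inner ℝ e y : ℝ) • e) + (s * δ) • (w - t • e) := by
      rw [hin]
      module
    have hwt : ‖w - t • e‖ ≤ 2 := by
      calc ‖w - t • e‖ ≤ ‖w‖ + ‖t • e‖ := norm_sub_le _ _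
        _ ≤ 2 := by
          rw [norm_smul, he, mul_one, Real.norm_eq_abs]
          linarith
    rw [hpt, hin]
    have hlip := hη.dist_le_mul ((y - (inner ℝ e y : ℝ) • e) + (s * δ) • (w - t • e))
      (y - (inner ℝ e y : ℝ) • e)
    rw [Real.dist_eq, dist_eq_norm, add_sub_cancel_left, norm_smul, Real.norm_eq_abs,
      abs_of_nonneg (mul_nonneg hs0 hδ0.le)] at hlip
    replace hlip := (le_abs_self _).trans hlip
    have h3 : (K : ℝ) * (s * δ * ‖w - t • e‖) ≤ s * (1 - δ) := by
      calc (K : ℝ) * (s * δ * ‖w - t • e‖) ≤ K * (s * δ * 2) := by gcongr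
        _ = s * (K * (2 * δ)) := by ring
        _ ≤ s * (1 - δ) := by gcongr
    have h4 : s * (1 - δ) ≤ s * (1 + δ * t) := by
      gcongr
      nlinarith [neg_le_of_abs_le ht1]
    linarith

lemma dirDeriv_comp_sub (ξ a : Sp d) (φ : Sp d → ℝ) :
    dirDeriv ξ (fun z => φ (z - a)) = fun z => dirDeriv ξ φ (z - a) := by
  funext z
  simp only [dirDeriv]
  rw [fderiv_comp_sub]

lemma IsTest.comp_sub (hφ : IsTest Ω φ) (a : Sp d) (ha : ∀ y ∈ tsupport φ, y + a ∈ Ω) :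
    IsTest Ω (fun z => φ (z - a)) := by
  refine ⟨hφ.1.comp (contDiff_id.sub contDiff_const),
    hφ.2.1.comp_homeomorph (Homeomorph.subRight a), ?_⟩
  intro z hz
  have := tsupport_comp_subset_preimage φ (f := fun z => z - a) (by fun_prop) hz
  simpa using ha _ this

lemma IsTest.norm_toL2 (hφ : IsTest Ω φ) : ‖hφ.toL2‖ = (eLpNorm φ 2 volume).toReal := by
  rw [IsTest.toL2, Lp.norm_toLp, eLpNorm_restrict_eq_of_support_subset]
  exact (subset_tsupport φ).trans hφ.2.2

lemma IsTest.norm_toL2_comp_sub (hφ : IsTest Ω φ) (a : Sp d)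
    (h : IsTest Ω (fun z => φ (z - a))) : ‖h.toL2‖ = ‖hφ.toL2‖ := by
  rw [h.norm_toL2, hφ.norm_toL2]
  congr 1
  exact eLpNorm_comp_measurePreserving (hφ.continuous.aestronglyMeasurable)
    (measurePreserving_sub_right volume a)

lemma IsTest.abs_setIntegral_le (hφ : IsTest Ω φ) (v : L2 Ω) :
    |∫ x in Ω, v x * φ x| ≤ ‖v‖ * ‖hφ.toL2‖ := by
  rw [← hφ.inner_toL2]
  exact abs_real_inner_le_norm _ _

/-- The derivative falls on the smooth factor, whose derivative is bounded; |v| times that bound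
dominates, so integrability of v suffices. -/
lemma IsTest.hasDerivAt_setIntegral_comp_sub (hφ : IsTest Ω φ) {v : Sp d → ℝ}
    (hv : Integrable v (volume.restrict Ω)) (ξ : Sp d) (s : ℝ) :
    HasDerivAt (fun s : ℝ => ∫ z in Ω, v z * φ (z - s • ξ))
      (- ∫ z in Ω, v z * Smectic.dirDeriv ξ φ (z - s • ξ)) s := by
  obtain ⟨C, hC⟩ := (hφ.dirDeriv ξ).continuous.bounded_above_of_compact_support
    (hφ.dirDeriv ξ).2.1
  obtain ⟨D, hD⟩ := hφ.continuous.bounded_above_of_compact_support hφ.2.1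
  have hc : ∀ s : ℝ, Continuous fun z : Sp d => φ (z - s • ξ) := fun s =>
    hφ.continuous.comp (by fun_prop)
  have hc' : ∀ s : ℝ, Continuous fun z : Sp d => Smectic.dirDeriv ξ φ (z - s • ξ) := fun s =>
    (hφ.dirDeriv ξ).continuous.comp (by fun_prop)
  have key := hasDerivAt_integral_of_dominated_loc_of_deriv_le (μ := volume.restrict Ω)
    (F := fun s z => v z * φ (z - s • ξ))
    (F' := fun s z => - (v z * Smectic.dirDeriv ξ φ (z - s • ξ)))
    (bound := fun z => ‖v z‖ * C) (x₀ := s) (s := Set.univ) univ_mem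
    (Eventually.of_forall fun s => hv.aestronglyMeasurable.mul (hc s).aestronglyMeasurable)
    (hv.mul_bdd (c := D) (hc s).aestronglyMeasurable (Eventually.of_forall fun z => hD _))
    ((hv.aestronglyMeasurable.mul (hc' s).aestronglyMeasurable).neg)
    (Eventually.of_forall fun z s _ => by
      rw [norm_neg, norm_mul]
      exact mul_le_mul_of_nonneg_left (hC _) (norm_nonneg _))
    (hv.norm.mul_const C)
    (Eventually.of_forall fun z s _ => by
      have h1 : HasDerivAt (fun s : ℝ => z - s • ξ) (-ξ) s := by
        simpa using ((hasDerivAt_id s).smul_const ξ).const_sub z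
      have h2 := (hφ.differentiable (z - s • ξ)).hasFDerivAt.comp_hasDerivAt s h1
      have h3 := h2.const_mul (v z)
      simpa [Smectic.dirDeriv] using h3)
  have h := key.2
  rwa [integral_neg] at h

/-- The contraction `∑ i j, ξ_i ξ_j H_ij` of a tensor field with a direction. -/
lemma exists_L2_contraction (H : L2S Ω) (ξ : Sp d) : ∃ k : L2 Ω, ∀ φ : Sp d → ℝ, IsTest Ω φ →
    ∫ x in Ω, k x * φ x = ∑ i, ∑ j, ξ i * ξ j * ∫ x in Ω, entry (H x) i j * φ x := by
  have hm : MemLp (fun x => ∑ i, ∑ j, ξ i * ξ j * entry (H x) i j) 2 (volume.restrict Ω) :=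
    memLp_finsetSum _ fun i _ => memLp_finsetSum _ fun j _ => (memLp_entry H i j).const_mul _
  refine ⟨hm.toLp _, fun φ hφ => ?_⟩
  have h1 : ∫ x in Ω, hm.toLp _ x * φ x
      = ∫ x in Ω, ∑ i, ∑ j, ξ i * ξ j * (entry (H x) i j * φ x) := by
    refine integral_congr_ae ?_
    filter_upwards [hm.coeFn_toLp] with x hx
    rw [hx, Finset.sum_mul]
    refine Finset.sum_congr rfl fun i _ => ?_
    rw [Finset.sum_mul]
    exact Finset.sum_congr rfl fun j _ => by ring
  rw [h1, integral_finsetSum _ fun i _ => integrable_finsetSum _ fun j _ =>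
    (integrable_entry_mul H hφ i j).const_mul _]
  refine Finset.sum_congr rfl fun i _ => ?_
  rw [integral_finsetSum _ fun j _ => (integrable_entry_mul H hφ i j).const_mul _]
  exact Finset.sum_congr rfl fun j _ => integral_const_mul _ _

lemma HasWeakHess.setIntegral_dirDeriv {v : L2 Ω} {H : L2S Ω} (h : HasWeakHess v H) (ξ : Sp d)
    (hφ : IsTest Ω φ) : ∫ x in Ω, v x * dirDeriv ξ (dirDeriv ξ φ) x
      = ∑ i, ∑ j, ξ i * ξ j * ∫ x in Ω, entry (H x) i j * φ x := by
  have h1 : ∀ x, v x * dirDeriv ξ (dirDeriv ξ φ) x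
      = ∑ i, ∑ j, ξ i * ξ j * (v x * pd i (pd j φ) x) := by
    intro x
    rw [dirDeriv_dirDeriv_eq_sum_pd hφ.1, Finset.mul_sum]
    refine Finset.sum_congr rfl fun i _ => ?_
    rw [Finset.mul_sum]
    exact Finset.sum_congr rfl fun j _ => by ring
  simp_rw [h1]
  rw [integral_finsetSum _ fun i _ => integrable_finsetSum _ fun j _ =>
    (integrable_mul_isTest v (hφ.pd_pd i j)).const_mul _]
  refine Finset.sum_congr rfl fun i _ => ?_
  rw [integral_finsetSum _ fun j _ => (integrable_mul_isTest v (hφ.pd_pd i j)).const_mul _]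
  exact Finset.sum_congr rfl fun j _ => by rw [integral_const_mul, h φ hφ i j]

/-- If the translations in the direction `ξ` map `U ∩ Ω` into `Ω`, then the derivative in this
direction of a function with a weak Hessian is bounded in `L₂(U ∩ Ω)`. -/
lemma HasWeakHess.exists_bound_dirDeriv (hb : Bornology.IsBounded Ω) {v : L2 Ω} {H : L2S Ω}
    (hH : HasWeakHess v H) {U : Set (Sp d)} {ξ : Sp d} {h : ℝ} (hh : 0 < h)
    (hU : ∀ y ∈ U ∩ Ω, ∀ s ∈ Set.Icc 0 h, y + s • ξ ∈ Ω) :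
    ∃ C, ∀ φ : Sp d → ℝ, ∀ hφ : IsTest Ω φ, tsupport φ ⊆ U →
      |∫ x in Ω, v x * dirDeriv ξ φ x| ≤ C * ‖hφ.toL2‖ := by
  obtain ⟨k, hk⟩ := exists_L2_contraction H ξ
  refine ⟨2 / h * ‖v‖ + h * ‖k‖, fun φ hφ hs => ?_⟩
  have : IsFiniteMeasure (volume.restrict Ω) := ⟨by simpa using hb.measure_lt_top⟩
  have hv : Integrable v (volume.restrict Ω) := (Lp.memLp v).integrable (by norm_num)
  have htest : ∀ s ∈ Set.Icc 0 h, IsTest Ω (fun z => φ (z - s • ξ)) := fun s hs' =>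
    hφ.comp_sub _ fun y hy => hU y ⟨hs hy, hφ.2.2 hy⟩ s hs'
  have hd2 : ∀ s : ℝ, HasDerivAt (fun s : ℝ => - ∫ z in Ω, v z * dirDeriv ξ φ (z - s • ξ))
      (∫ z in Ω, v z * dirDeriv ξ (dirDeriv ξ φ) (z - s • ξ)) s := fun s => by
    have hn := ((hφ.dirDeriv ξ).hasDerivAt_setIntegral_comp_sub hv ξ s).neg
    rw [neg_neg] at hn
    exact hn
  -- Interpolation for F(s) = ∫ v φ(· - sξ). The translates remain test functions of the same L₂
  -- norm, F'' pairs them with k = ξ·Hξ, and F'(0) = -∫ v ∂_ξ φ.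
  have key := exists_deriv_bound (A := ‖v‖ * ‖hφ.toL2‖) (B := ‖k‖ * ‖hφ.toL2‖) hh
    (fun s => hφ.hasDerivAt_setIntegral_comp_sub hv ξ s) hd2 ?_ ?_
  · simp only [zero_smul, sub_zero, abs_neg] at key
    calc _ ≤ _ := key
      _ = _ := by ring
  · intro s hs'
    rw [← hφ.norm_toL2_comp_sub _ (htest s hs')]
    exact (htest s hs').abs_setIntegral_le v
  · intro s hs'
    rw [← hφ.norm_toL2_comp_sub _ (htest s hs')]
    have h1 := hH.setIntegral_dirDeriv ξ (htest s hs')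
    rw [← hk _ (htest s hs'), dirDeriv_comp_sub, dirDeriv_comp_sub] at h1
    rw [h1]
    exact (htest s hs').abs_setIntegral_le k

/-- Two directions of the local cone, e + δe_i and e, differ by δe_i; the bounds along them
therefore control ∂_i. -/
lemma HasWeakHess.exists_local_bound_pd (hΩ : IsOpen Ω) (hb : Bornology.IsBounded Ω)
    (hL : IsLipschitzSet Ω) {v : L2 Ω} {H : L2S Ω} (hH : HasWeakHess v H) {x : Sp d}
    (hx : x ∈ closure Ω) (i : Fin d) :
    ∃ U, IsOpen U ∧ x ∈ U ∧ ∃ C, ∀ φ : Sp d → ℝ, ∀ hφ : IsTest Ω φ, tsupport φ ⊆ U →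
      |∫ x in Ω, v x * pd i φ x| ≤ C * ‖hφ.toL2‖ := by
  obtain ⟨U, e, δ, h, hUo, hxU, hδ, hh, hU⟩ := hL.exists_cone hΩ hx
  refine ⟨U, hUo, hxU, ?_⟩
  obtain ⟨C₀, h₀⟩ := hH.exists_bound_dirDeriv hb hh (hU 0 (by simp))
  obtain ⟨C₁, h₁⟩ := hH.exists_bound_dirDeriv hb hh (hU (EuclideanSpace.single i 1) (by simp))
  refine ⟨(C₁ + C₀) / δ, fun φ hφ hs => ?_⟩
  have e1 : ∀ x, v x * pd i φ x = δ⁻¹ * (v x * dirDeriv (e + δ • EuclideanSpace.single i 1) φ x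
      - v x * dirDeriv (e + δ • (0 : Sp d)) φ x) := by
    intro x
    simp only [dirDeriv, pd, map_add, map_smul, smul_zero, add_zero, smul_eq_mul]
    field_simp
    ring
  simp_rw [e1]
  rw [integral_const_mul, integral_sub (integrable_mul_isTest v (hφ.dirDeriv _))
    (integrable_mul_isTest v (hφ.dirDeriv _)), abs_mul, abs_of_pos (inv_pos.2 hδ)]
  calc δ⁻¹ * _ ≤ δ⁻¹ * (C₁ * ‖hφ.toL2‖ + C₀ * ‖hφ.toL2‖) := by
        gcongr
        exact (abs_sub _ _).trans (add_le_add (h₁ φ hφ hs) (h₀ φ hφ hs))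
    _ = (C₁ + C₀) / δ * ‖hφ.toL2‖ := by ring

lemma IsTest.norm_toL2_mul_le (hφ : IsTest Ω φ) {χ : Sp d → ℝ} (hχ : ∀ x, |χ x| ≤ 1)
    (h : IsTest Ω (fun x => χ x * φ x)) : ‖h.toL2‖ ≤ ‖hφ.toL2‖ := by
  rw [h.norm_toL2, hφ.norm_toL2]
  refine ENNReal.toReal_mono (hφ.memLp 2 volume).eLpNorm_ne_top (eLpNorm_mono fun x => ?_)
  rw [norm_mul]
  exact mul_le_of_le_one_left (norm_nonneg _) (hχ x)

/-- The closure of Ω is compact, so finitely many local bounds and a subordinate partition of unity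
suffice. The local bounds involve only the norm of χ_k φ, so derivatives of the cutoffs do not
appear. -/
lemma HasWeakHess.exists_bound_pd (hΩ : IsOpen Ω) (hb : Bornology.IsBounded Ω)
    (hL : IsLipschitzSet Ω) {v : L2 Ω} {H : L2S Ω} (hH : HasWeakHess v H) (i : Fin d) :
    ∃ C, ∀ φ : Sp d → ℝ, ∀ hφ : IsTest Ω φ,
      |∫ x in Ω, v x * pd i φ x| ≤ C * ‖hφ.toL2‖ := by
  choose! U hUo hxU C hC using fun x (hx : x ∈ closure Ω) =>
    hH.exists_local_bound_pd hΩ hb hL hx i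
  obtain ⟨t, ht, hcov⟩ := hb.isCompact_closure.elim_nhds_subcover U
    fun x hx => (hUo x hx).mem_nhds (hxU x hx)
  obtain ⟨χ, hχ⟩ := SmoothPartitionOfUnity.exists_isSubordinate (modelWithCornersSelf ℝ (Sp d))
    (isClosed_closure (s := Ω)) (fun k : t => U k) (fun k => hUo k (ht k k.2))
    (by simpa [Set.iUnion_subtype] using hcov)
  have hsm : ∀ k, ContDiff ℝ ∞ (χ k) := fun k => (χ k).contMDiff.contDiff
  refine ⟨∑ k : t, |C k|, fun φ hφ => ?_⟩
  have htest : ∀ k, IsTest Ω (fun x => χ k x * φ x) := fun k => hφ.mul_left (hsm k)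
  have hsum : φ = fun x => ∑ k, χ k x * φ x := by
    funext x
    rw [← Finset.sum_mul]
    by_cases hx : x ∈ Ω
    · have := χ.sum_eq_one (subset_closure hx)
      rw [finsum_eq_sum_of_fintype] at this
      rw [this, one_mul]
    · rw [hφ.eq_zero_of_notMem hx, mul_zero]
  have hpd : ∀ x, v x * pd i φ x = ∑ k, v x * pd i (fun x => χ k x * φ x) x := by
    intro x
    rw [← Finset.mul_sum]
    congr 1
    conv_lhs => rw [hsum]
    unfold pd
    rw [fderiv_fun_sum fun k _ => (htest k).differentiable x]
    simp only [_root_.sum_apply]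
  simp_rw [hpd]
  rw [integral_finsetSum _ fun k _ => integrable_mul_isTest v ((htest k).pd i), Finset.sum_mul]
  refine (Finset.abs_sum_le_sum_abs _ _).trans (Finset.sum_le_sum fun k _ => ?_)
  have hk : tsupport (fun x => χ k x * φ x) ⊆ U k :=
    (closure_mono (Function.support_mul_subset_left _ _)).trans (hχ k)
  refine (hC k (ht k k.2) _ (htest k) hk).trans ?_
  have h1 := hφ.norm_toL2_mul_le (χ := χ k)
    (fun x => by
      rw [abs_of_nonneg (χ.nonneg k x)]
      exact χ.le_one k x) (htest k)
  calc C k * ‖(htest k).toL2‖ ≤ |C k| * ‖(htest k).toL2‖ := by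
        gcongr
        exact le_abs_self _
    _ ≤ |C k| * ‖hφ.toL2‖ := by gcongr

variable (Ω) in
/-- The space of test functions. -/
def testSpace : Submodule ℝ (Sp d → ℝ) where
  carrier := {φ | IsTest Ω φ}
  zero_mem' := isTest_zero
  add_mem' h h' := h.add h'
  smul_mem' c _ h := h.const_smul c

variable (Ω) in
/-- The inclusion of the test functions in `L₂(Ω)`. -/
def testToL2 : testSpace Ω →ₗ[ℝ] L2 Ω where
  toFun φ := IsTest.toL2 φ.2
  map_add' _ _ := rfl
  map_smul' _ _ := rfl

/-- The functional `φ ↦ ∫ v ∂_i φ` on the test functions. -/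
def integralPd (v : L2 Ω) (i : Fin d) : testSpace Ω →ₗ[ℝ] ℝ where
  toFun φ := ∫ x in Ω, v x * pd i φ x
  map_add' φ ψ := by
    have hφ : IsTest Ω φ := φ.2
    have hψ : IsTest Ω ψ := ψ.2
    rw [← integral_add (integrable_mul_isTest v (hφ.pd i)) (integrable_mul_isTest v (hψ.pd i))]
    congr 1
    funext x
    rw [← mul_add]
    unfold pd
    rw [Submodule.coe_add, fderiv_add (hφ.differentiable x) (hψ.differentiable x)]
    rfl
  map_smul' c φ := by
    have hφ : IsTest Ω φ := φ.2
    rw [RingHom.id_apply, smul_eq_mul, ← integral_const_mul]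
    congr 1
    funext x
    unfold pd
    rw [Submodule.coe_smul, fderiv_const_smul (hφ.differentiable x)]
    simp
    ring

/-- On a bounded Lipschitz set, a function in `L₂` with a weak Hessian in `L₂` has a weak gradient
in `L₂`. -/
theorem HasWeakHess.exists_hasWeakGrad (hΩ : IsOpen Ω) (hb : Bornology.IsBounded Ω)
    (hL : IsLipschitzSet Ω) {v : L2 Ω} {H : L2S Ω} (hH : HasWeakHess v H) :
    ∃ p, HasWeakGrad v p := by
  have h1 : ∀ i : Fin d, ∃ k : L2 Ω, ∀ φ : Sp d → ℝ, IsTest Ω φ →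
      ∫ x in Ω, v x * pd i φ x = ∫ x in Ω, k x * φ x := by
    intro i
    obtain ⟨C, hC⟩ := hH.exists_bound_pd hΩ hb hL i
    obtain ⟨k, hk⟩ := exists_inner_eq_of_abs_le (testToL2 Ω) (integralPd v i) C
      fun φ => hC φ φ.2
    exact ⟨k, fun φ hφ => (hk ⟨φ, hφ⟩).trans (hφ.inner_toL2 k)⟩
  choose k hk using h1
  -- The sign is the one in the integration by parts that defines the weak gradient.
  have hm : MemLp (fun x => ∑ i, (-k i x) • EuclideanSpace.single i (1 : ℝ) : Sp d → Sp d) 2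
      (volume.restrict Ω) :=
    memLp_finsetSum _ fun i _ => (ContinuousLinearMap.toSpanSingleton ℝ
      (EuclideanSpace.single i (1 : ℝ))).comp_memLp' (Lp.memLp (k i)).neg
  refine ⟨hm.toLp _, fun φ hφ i => ?_⟩
  rw [hk i φ hφ, ← integral_neg]
  refine integral_congr_ae ?_
  filter_upwards [hm.coeFn_toLp] with x hx
  rw [hx]
  simp [Pi.single_apply]

end Interior

end

end Smectic
namespace Smectic

noncomputable section

/-! ### An affine projection in a Hilbert space -/

section Hilbert

variable {E : Type*} [NormedAddCommGroup E] [InnerProductSpace ℝ E] (K : Submodule ℝ E)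

/-- `x` is the projection of `F` onto the affine space `G + K`. -/
def IsAffineProj (F G x : E) : Prop := x - G ∈ K ∧ ∀ k ∈ K, inner ℝ x k = inner ℝ F k

variable {K}

lemma exists_isAffineProj [K.HasOrthogonalProjection] (F G : E) : ∃ x, IsAffineProj K F G x := by
  refine ⟨G + K.starProjection (F - G), ?_, fun k hk => ?_⟩
  · rw [add_sub_cancel_left]
    exact K.starProjection_apply_mem _
  · have h := K.starProjection_inner_eq_zero (F - G) k hk
    rw [inner_sub_left, inner_sub_left] at h
    rw [inner_add_left]
    linarith

lemma IsAffineProj.unique {F G x y : E} (hx : IsAffineProj K F G x) (hy : IsAffineProj K F G y) :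
    x = y := by
  have hxy : x - y ∈ K := by simpa using K.sub_mem hx.1 hy.1
  have h : (inner ℝ (x - y) (x - y) : ℝ) = 0 := by
    conv_lhs => rw [inner_sub_left (x := x), hx.2 _ hxy, hy.2 _ hxy, sub_self]
  exact sub_eq_zero.1 (inner_self_eq_zero.1 h)

/-- Testing with x - G gives ‖x - G‖² = ⟨F - G, x - G⟩, so ‖x - G‖ ≤ ‖F‖ + ‖G‖; returning to x costs
the second ‖G‖. -/
lemma IsAffineProj.norm_le {F G x : E} (hx : IsAffineProj K F G x) : ‖x‖ ≤ ‖F‖ + 2 * ‖G‖ := by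
  have h : ‖x - G‖ * ‖x - G‖ ≤ (‖F‖ + ‖G‖) * ‖x - G‖ := by
    rw [← real_inner_self_eq_norm_mul_norm, inner_sub_left (x := x), hx.2 _ hx.1,
      ← inner_sub_left]
    exact (real_inner_le_norm _ _).trans (by gcongr; exact norm_sub_le _ _)
  have h1 : ‖x - G‖ ≤ ‖F‖ + ‖G‖ := by
    by_contra! hlt
    have h0 : 0 < ‖x - G‖ := lt_of_le_of_lt (by positivity) hlt
    exact absurd (le_of_mul_le_mul_right h h0) (not_le.2 hlt)
  have h2 : ‖x‖ ≤ ‖x - G‖ + ‖G‖ := by simpa using norm_add_le (x - G) G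
  linarith

end Hilbert

section Problem

variable {d : ℕ} {Ω : Set (Sp d)}

/-! ### Inner products in `L₂(Ω; 𝐒)` -/

lemma innerS_add_right (M N P : L2S Ω) : inner ℝ P (M + N) = inner ℝ P M + inner ℝ P N :=
  inner_add_right (𝕜 := ℝ) P M N

lemma innerS_sub_left (M N P : L2S Ω) : inner ℝ (M - N) P = inner ℝ M P - inner ℝ N P :=
  inner_sub_left (𝕜 := ℝ) M N P

lemma innerS_smul_left (c : ℝ) (M N : L2S Ω) : inner ℝ (c • M) N = c * inner ℝ M N :=
  real_inner_smul_left M N c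

lemma innerS_smul_right (c : ℝ) (M N : L2S Ω) : inner ℝ M (c • N) = c * inner ℝ M N :=
  real_inner_smul_right M N c

lemma innerS_neg_right (M N : L2S Ω) : inner ℝ M (-N) = -inner ℝ M N :=
  inner_neg_right (𝕜 := ℝ) M N

lemma innerS_comm (M N : L2S Ω) : inner ℝ M N = inner ℝ N M := real_inner_comm N M

lemma innerS_self (M : L2S Ω) : inner ℝ M M = ‖M‖ ^ 2 := real_inner_self_eq_norm_sq M

variable (Ω) in
/-- The Hilbert space `L₂(Ω; 𝐒) × L₂(Ω)`. -/
def TensorScalar : Type := WithLp 2 (L2S Ω × L2 Ω)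

instance : NormedAddCommGroup (TensorScalar Ω) :=
  inferInstanceAs (NormedAddCommGroup (WithLp 2 (L2S Ω × L2 Ω)))

instance : InnerProductSpace ℝ (TensorScalar Ω) :=
  inferInstanceAs (InnerProductSpace ℝ (WithLp 2 (L2S Ω × L2 Ω)))

instance : CompleteSpace (TensorScalar Ω) :=
  inferInstanceAs (CompleteSpace (WithLp 2 (L2S Ω × L2 Ω)))

lemma innerS_zero_left (M : L2S Ω) : inner ℝ (0 : L2S Ω) M = 0 := inner_zero_left (𝕜 := ℝ) M

lemma normS_zero : ‖(0 : L2S Ω)‖ = 0 := Lp.norm_zero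

lemma normS_neg (M : L2S Ω) : ‖-M‖ = ‖M‖ := norm_neg M

lemma normS_smul (c : ℝ) (M : L2S Ω) : ‖c • M‖ = |c| * ‖M‖ := by
  have h0 : ∀ N : L2S Ω, 0 ≤ ‖N‖ := fun N => norm_nonneg N
  refine (pow_left_inj₀ (h0 _) (mul_nonneg (abs_nonneg c) (h0 M)) two_ne_zero).1 ?_
  rw [← innerS_self, innerS_smul_left, innerS_smul_right, innerS_self, mul_pow, sq_abs]
  ring

lemma smul_inv_smulS {a : ℝ} (ha : a ≠ 0) (M : L2S Ω) : a • a⁻¹ • M = M :=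
  smul_inv_smul₀ ha M

/-- The pair of a tensor field and a scalar field. -/
def mkPair (M : L2S Ω) (v : L2 Ω) : TensorScalar Ω := WithLp.toLp 2 (M, v)

lemma inner_mkPair (M N : L2S Ω) (v w : L2 Ω) :
    inner ℝ (mkPair M v) (mkPair N w) = inner ℝ M N + inner ℝ v w :=
  WithLp.prod_inner_apply _ _

lemma norm_mkPair (M : L2S Ω) (v : L2 Ω) :
    ‖mkPair M v‖ = Real.sqrt (‖M‖ ^ 2 + ‖v‖ ^ 2) := WithLp.prod_norm_eq_of_L2 _

lemma norm_mkPair_zero (v : L2 Ω) : ‖mkPair 0 v‖ = ‖v‖ := by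
  rw [norm_mkPair, normS_zero, zero_pow two_ne_zero, zero_add, Real.sqrt_sq (norm_nonneg _)]

lemma mkPair_add (M N : L2S Ω) (v w : L2 Ω) :
    mkPair (M + N) (v + w) = mkPair M v + mkPair N w := rfl

lemma mkPair_smul (c : ℝ) (M : L2S Ω) (v : L2 Ω) : mkPair (c • M) (c • v) = c • mkPair M v := rfl

lemma exists_mkPair_smul {a b : ℝ} (ha : a ≠ 0) (hb : b ≠ 0) (p : TensorScalar Ω) :
    ∃ (M : L2S Ω) (v : L2 Ω), mkPair (a • M) (b • v) = p := by
  let M : L2S Ω := (WithLp.ofLp p).1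
  let v : L2 Ω := (WithLp.ofLp p).2
  refine ⟨a⁻¹ • M, b⁻¹ • v, ?_⟩
  rw [smul_inv_smulS ha, smul_inv_smul₀ hb]
  rfl

/-! ### Linearity of the operators -/

lemma divDiv_add (hΩ : IsOpen Ω) {M N : L2S Ω} (hM : M ∈ HdivDiv Ω) (hN : N ∈ HdivDiv Ω) :
    divDiv (M + N) = divDiv M + divDiv N :=
  ((hasWeakDivDiv_divDiv hM).add (hasWeakDivDiv_divDiv hN)).divDiv_eq hΩ

lemma add_mem_HdivDiv {M N : L2S Ω} (hM : M ∈ HdivDiv Ω) (hN : N ∈ HdivDiv Ω) :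
    M + N ∈ HdivDiv Ω :=
  ⟨_, (hasWeakDivDiv_divDiv hM).add (hasWeakDivDiv_divDiv hN)⟩

lemma divDiv_smul (hΩ : IsOpen Ω) {M : L2S Ω} (hM : M ∈ HdivDiv Ω) (c : ℝ) :
    divDiv (c • M) = c • divDiv M :=
  ((hasWeakDivDiv_divDiv hM).const_smul c).divDiv_eq hΩ

lemma smul_mem_HdivDiv {M : L2S Ω} (hM : M ∈ HdivDiv Ω) (c : ℝ) : c • M ∈ HdivDiv Ω :=
  ⟨_, (hasWeakDivDiv_divDiv hM).const_smul c⟩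

/-! ### Isometric images of tensors and of scalar functions. -/

variable (m q B : ℝ) (T : LinfS Ω)

/-- The operator `∇∇v + q² T v`. -/
def hessT (v : L2 Ω) : L2S Ω := hess v + q ^ 2 • tmul T v

/-- The isometric image of `M` for the inner product of `H(div div, Ω; 𝐒)`. -/
def hat (M : L2S Ω) : TensorScalar Ω :=
  mkPair (Real.sqrt B • M) ((B / Real.sqrt m) • divDivT q T M)

/-- The isometric image of `v` for the norm `‖v‖_Ggrad`, such that the trace functional is the
product with the image of `M`. -/
def chk (v : L2 Ω) : TensorScalar Ω :=
  mkPair (-(Real.sqrt B • hessT q T v)) (Real.sqrt m • v)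

variable {m q B T}

lemma inner_divDivT (N : L2S Ω) (v : L2 Ω) :
    inner ℝ (divDivT q T N) v = inner ℝ (divDiv N) v + q ^ 2 * inner ℝ N (tmul T v) := by
  rw [divDivT, inner_add_left, real_inner_smul_left, inner_frob]

/-- By adjointness the two T-terms cancel, so the trace functional may be written with the perturbed
operators. -/
lemma trGgrad_eq (N : L2S Ω) (v : L2 Ω) :
    trGgrad v N = inner ℝ (divDivT q T N) v - inner ℝ N (hessT q T v) := by
  rw [trGgrad, inner_divDivT, hessT, innerS_add_right, innerS_smul_right]
  ring

lemma divDivT_add (hΩ : IsOpen Ω) {M N : L2S Ω} (hM : M ∈ HdivDiv Ω) (hN : N ∈ HdivDiv Ω) :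
    divDivT q T (M + N) = divDivT q T M + divDivT q T N := by
  simp only [divDivT, divDiv_add hΩ hM hN, frob_add]
  module

lemma divDivT_smul (hΩ : IsOpen Ω) {M : L2S Ω} (hM : M ∈ HdivDiv Ω) (c : ℝ) :
    divDivT q T (c • M) = c • divDivT q T M := by
  simp only [divDivT, divDiv_smul hΩ hM, frob_smul]
  module

lemma hat_add (hΩ : IsOpen Ω) {M N : L2S Ω} (hM : M ∈ HdivDiv Ω) (hN : N ∈ HdivDiv Ω) :
    hat m q B T (M + N) = hat m q B T M + hat m q B T N := by
  simp only [hat, divDivT_add hΩ hM hN, smul_add, mkPair_add]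

lemma hat_smul (hΩ : IsOpen Ω) {M : L2S Ω} (hM : M ∈ HdivDiv Ω) (c : ℝ) :
    hat m q B T (c • M) = c • hat m q B T M := by
  simp only [hat, divDivT_smul hΩ hM]
  rw [smul_comm (Real.sqrt B) c, smul_comm (B / Real.sqrt m) c, mkPair_smul]

lemma hat_sub (hΩ : IsOpen Ω) {M N : L2S Ω} (hM : M ∈ HdivDiv Ω) (hN : N ∈ HdivDiv Ω) :
    hat m q B T (M - N) = hat m q B T M - hat m q B T N := by
  have h : M - N = M + (-1 : ℝ) • N := by module
  rw [h, hat_add hΩ hM (smul_mem_HdivDiv hN _), hat_smul hΩ hN]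
  module

lemma sub_mem_HdivDiv {M N : L2S Ω} (hM : M ∈ HdivDiv Ω) (hN : N ∈ HdivDiv Ω) :
    M - N ∈ HdivDiv Ω := by
  have h : M - N = M + (-1 : ℝ) • N := by module
  rw [h]
  exact add_mem_HdivDiv hM (smul_mem_HdivDiv hN _)

lemma inner_hat_hat (hm : 0 < m) (hB : 0 < B) (M N : L2S Ω) :
    inner ℝ (hat m q B T M) (hat m q B T N) = innerDivDiv m q B T M N := by
  rw [hat, hat, inner_mkPair]
  simp only [innerDivDiv, innerS_smul_left, innerS_smul_right, real_inner_smul_left,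
    real_inner_smul_right, ← mul_assoc]
  rw [Real.mul_self_sqrt hB.le, div_mul_div_comm, Real.mul_self_sqrt hm.le, ← sq]

lemma norm_hat (hm : 0 < m) (hB : 0 < B) (M : L2S Ω) :
    ‖hat m q B T M‖ = normDivDiv m q B T M := by
  rw [normDivDiv, ← inner_hat_hat hm hB, real_inner_self_eq_norm_sq, Real.sqrt_sq (norm_nonneg _)]

lemma norm_chk (hm : 0 < m) (hB : 0 < B) (v : L2 Ω) :
    ‖chk m q B T v‖ = normGgrad m q B T v := by
  rw [normGgrad, chk, norm_mkPair]
  simp only [normS_neg, normS_smul, norm_smul, mul_pow, Real.norm_eq_abs, sq_abs, Real.sq_sqrt hm.le,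
    Real.sq_sqrt hB.le]
  rw [add_comm]
  rfl

/-- The weights are chosen so that √B·√B and (B/√m)·√m both equal B, and the sign in `chk` produces
the difference. -/
lemma inner_hat_chk (hm : 0 < m) (hB : 0 < B) (N : L2S Ω) (v : L2 Ω) :
    inner ℝ (hat m q B T N) (chk m q B T v) = B * trGgrad v N := by
  rw [hat, chk, inner_mkPair, trGgrad_eq (q := q) (T := T)]
  simp only [innerS_neg_right, innerS_smul_left, innerS_smul_right,
    real_inner_smul_left, real_inner_smul_right, ← mul_assoc]
  have h1 := Real.mul_self_sqrt hB.le
  have h2 : Real.sqrt m * (B / Real.sqrt m) = B := mul_div_cancel₀ _ (Real.sqrt_pos.2 hm).ne'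
  rw [h1, h2]
  ring

/-! ### The space `H_N(div div, Ω; 𝐒)` as an orthogonal complement -/

variable (m q B T) in
/-- The isometric image of `H_N(div div, Ω; 𝐒)`. -/
def hatHN (Γ : BoundaryDecomposition Ω) : Submodule ℝ (TensorScalar Ω) :=
  (Submodule.span ℝ (chk m q B T '' (H2D Γ ∪ {v | ∃ φ, ∃ h : IsTest Ω φ, h.toL2 = v})))ᗮ

lemma mem_hatHN_iff {Γ : BoundaryDecomposition Ω} {p : TensorScalar Ω} :
    p ∈ hatHN m q B T Γ ↔ (∀ v ∈ H2D Γ, inner ℝ p (chk m q B T v) = 0) ∧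
      ∀ φ, ∀ h : IsTest Ω φ, inner ℝ p (chk m q B T h.toL2) = 0 := by
  rw [hatHN, Submodule.mem_orthogonal']
  constructor
  · intro h
    exact ⟨fun v hv => h _ (Submodule.subset_span ⟨v, Or.inl hv, rfl⟩),
      fun φ hφ => h _ (Submodule.subset_span ⟨_, Or.inr ⟨φ, hφ, rfl⟩, rfl⟩)⟩
  · rintro ⟨h1, h2⟩ x hx
    induction hx using Submodule.span_induction with
    | mem x hx =>
      obtain ⟨v, hv | ⟨φ, hφ, rfl⟩, rfl⟩ := hx
      · exact h1 v hv
      · exact h2 φ hφ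
    | zero => exact inner_zero_right _
    | add x y _ _ hx hy => rw [inner_add_right, hx, hy, add_zero]
    | smul c x _ hx => rw [real_inner_smul_right, hx, mul_zero]

lemma trGgrad_toL2 (hΩ : IsOpen Ω) {N : L2S Ω} (hN : N ∈ HdivDiv Ω) {φ : Sp d → ℝ}
    (h : IsTest Ω φ) : trGgrad h.toL2 N = 0 := by
  rw [trGgrad, h.hasWeakHess.hess_eq hΩ, hasWeakDivDiv_iff.1 (hasWeakDivDiv_divDiv hN) φ h,
    sub_self]

/-- The test functions adjoined in `hatHN` cost nothing here: their trace against any tensor of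
H(div div) vanishes. -/
lemma mem_HNdivDiv_iff (hΩ : IsOpen Ω) (hm : 0 < m) (hB : 0 < B) {Γ : BoundaryDecomposition Ω}
    {N : L2S Ω} : N ∈ HNdivDiv Γ ↔ N ∈ HdivDiv Ω ∧ hat m q B T N ∈ hatHN m q B T Γ := by
  rw [mem_hatHN_iff]
  simp only [inner_hat_chk hm hB]
  constructor
  · rintro ⟨h1, h2⟩
    refine ⟨h1, fun v hv => ?_, fun φ h => ?_⟩
    · rw [show trGgrad v N = 0 from h2 v hv, mul_zero]
    · rw [trGgrad_toL2 hΩ h1 h, mul_zero]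
  · rintro ⟨h1, h2, -⟩
    exact ⟨h1, fun v hv => (mul_eq_zero.1 (h2 v hv)).resolve_left hB.ne'⟩

/-- Write p = (√B N, (B/√m) z). Orthogonality to `chk φ` for all test φ says exactly that z - q² T:N
is the weak div div of N. This replaces a separate proof that H(div div) is complete. -/
lemma exists_hat_eq (hΩ : IsOpen Ω) (hm : 0 < m) (hB : 0 < B) {Γ : BoundaryDecomposition Ω}
    {p : TensorScalar Ω} (hp : p ∈ hatHN m q B T Γ) :
    ∃ N ∈ HdivDiv Ω, hat m q B T N = p := by
  have hB' := Real.sqrt_pos.2 hB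
  have hm' := Real.sqrt_pos.2 hm
  obtain ⟨N, z, rfl⟩ := exists_mkPair_smul hB'.ne' (div_pos hB hm').ne' p
  have hw : HasWeakDivDiv N (z - q ^ 2 • frob T N) := by
    rw [hasWeakDivDiv_iff]
    intro φ h
    have h0 := (mem_hatHN_iff.1 hp).2 φ h
    rw [chk, inner_mkPair, innerS_neg_right, innerS_smul_left, innerS_smul_right,
      real_inner_smul_left, real_inner_smul_right, ← mul_assoc, ← mul_assoc,
      Real.mul_self_sqrt hB.le, div_mul_cancel₀ _ hm'.ne', hessT, h.hasWeakHess.hess_eq hΩ,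
      innerS_add_right, innerS_smul_right] at h0
    rw [inner_sub_left, real_inner_smul_left, inner_frob]
    have h1 : B * (inner ℝ z h.toL2 - (inner ℝ N (toL2S h.pd_pd)
        + q ^ 2 * inner ℝ N (tmul T h.toL2))) = 0 := by linarith
    have h2 := (mul_eq_zero.1 h1).resolve_left hB.ne'
    linarith
  refine ⟨N, ⟨_, hw⟩, ?_⟩
  have e3 : divDivT q T N = z := by
    rw [divDivT, hw.divDiv_eq hΩ, sub_add_cancel]
  rw [hat, e3]

/-! ### The variational problem as an affine projection. -/

variable (m q B T) in
/-- The element that represents the right-hand side of the variational problem. -/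
def load (f g : L2 Ω) : TensorScalar Ω :=
  mkPair 0 ((1 / Real.sqrt m) • f) - chk m q B T g

lemma inner_load_hat (hm : 0 < m) (hB : 0 < B) (f g : L2 Ω) (N : L2S Ω) :
    inner ℝ (load m q B T f g) (hat m q B T N)
      = B / m * inner ℝ f (divDivT q T N) - B * trGgrad g N := by
  rw [load, inner_sub_left, real_inner_comm _ (chk m q B T g), inner_hat_chk hm hB, hat,
    inner_mkPair]
  rw [innerS_zero_left, real_inner_smul_left, real_inner_smul_right, ← mul_assoc,
    div_mul_div_comm, Real.mul_self_sqrt hm.le]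
  ring

lemma norm_load_le (hm : 0 < m) (hB : 0 < B) (f g : L2 Ω) :
    ‖load m q B T f g‖ ≤ 1 / Real.sqrt m * ‖f‖ + normGgrad m q B T g := by
  refine (norm_sub_le _ _).trans ?_
  rw [norm_chk hm hB, norm_mkPair_zero, norm_smul, Real.norm_eq_abs, abs_of_nonneg (by positivity)]

/-- The condition on the trace of M puts M - G in H_N; the variational equation makes `hat M` and
`load` agree on `hatHN`, all of whose elements are images of admissible δM by `exists_hat_eq`. -/
lemma isSolution_iff (hΩ : IsOpen Ω) (hm : 0 < m) (hB : 0 < B) {Γ : BoundaryDecomposition Ω}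
    {f g : L2 Ω} {G M : L2S Ω} (hG : G ∈ HdivDiv Ω) :
    IsSolution m q B T Γ f G g M ↔ M ∈ HdivDiv Ω ∧
      IsAffineProj (hatHN m q B T Γ) (load m q B T f g) (hat m q B T G) (hat m q B T M) := by
  refine and_congr_right fun hM => ?_
  rw [IsAffineProj, and_comm]
  refine and_congr ?_ ?_
  · have h1 : ∀ v, trDivDiv (M - G) v = trDivDiv M v - trDivDiv G v := by
      intro v
      have h := inner_hat_chk (q := q) (T := T) hm hB (M - G) v
      rw [hat_sub hΩ hM hG, inner_sub_left, inner_hat_chk hm hB, inner_hat_chk hm hB,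
        ← mul_sub] at h
      exact (mul_left_cancel₀ hB.ne' h).symm
    have h2 := mem_HNdivDiv_iff (q := q) (T := T) hΩ hm hB (Γ := Γ) (N := M - G)
    rw [hat_sub hΩ hM hG] at h2
    constructor
    · intro h
      refine (h2.1 ⟨sub_mem_HdivDiv hM hG, fun v hv => ?_⟩).2
      rw [h1, h v hv, sub_self]
    · intro h v hv
      have h3 := (h2.2 ⟨sub_mem_HdivDiv hM hG, h⟩).2 v hv
      rw [h1] at h3
      exact sub_eq_zero.1 h3
  · constructor
    · intro h p hp
      obtain ⟨N, hN, rfl⟩ := exists_hat_eq hΩ hm hB hp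
      rw [inner_hat_hat hm hB, inner_load_hat hm hB]
      exact h N ((mem_HNdivDiv_iff hΩ hm hB).2 ⟨hN, hp⟩)
    · intro h N hN
      rw [← inner_hat_hat hm hB, ← inner_load_hat hm hB]
      exact h _ ((mem_HNdivDiv_iff hΩ hm hB).1 hN).2

lemma hat_injective (hB : 0 < B) : Function.Injective (hat m q B T) := by
  intro M N h
  have h1 : Real.sqrt B • M = Real.sqrt B • N := congrArg (fun p => (WithLp.ofLp p).1) h
  exact smul_right_injective _ (Real.sqrt_pos.2 hB).ne' h1

theorem existsUnique_isSolution (hΩ : IsOpen Ω) (hm : 0 < m) (hB : 0 < B)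
    (Γ : BoundaryDecomposition Ω) (f g : L2 Ω) {G : L2S Ω} (hG : G ∈ HdivDiv Ω) :
    ∃! M : L2S Ω, IsSolution m q B T Γ f G g M := by
  have : CompleteSpace (hatHN m q B T Γ) := Submodule.instOrthogonalCompleteSpace _
  obtain ⟨x, hx⟩ := exists_isAffineProj (K := hatHN m q B T Γ) (load m q B T f g)
    (hat m q B T G)
  obtain ⟨N, hN, hNx⟩ := exists_hat_eq hΩ hm hB hx.1
  have hGN : hat m q B T (G + N) = x := by
    rw [hat_add hΩ hG hN, hNx]
    abel
  refine ⟨G + N, (isSolution_iff hΩ hm hB hG).2 ⟨add_mem_HdivDiv hG hN, hGN ▸ hx⟩, ?_⟩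
  intro M hM
  exact hat_injective (m := m) (q := q) (T := T) hB
    ((((isSolution_iff hΩ hm hB hG).1 hM).2.unique hx).trans hGN.symm)

theorem IsSolution.normDivDiv_le (hΩ : IsOpen Ω) (hm : 0 < m) (hB : 0 < B)
    {Γ : BoundaryDecomposition Ω} {f g : L2 Ω} {G M : L2S Ω} (hG : G ∈ HdivDiv Ω)
    (h : IsSolution m q B T Γ f G g M) :
    normDivDiv m q B T M
      ≤ 1 / Real.sqrt m * ‖f‖ + 2 * normDivDiv m q B T G + normGgrad m q B T g := by
  have h1 := ((isSolution_iff hΩ hm hB hG).1 h).2.norm_le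
  rw [norm_hat hm hB, norm_hat hm hB] at h1
  linarith [norm_load_le (q := q) (T := T) hm hB f g]

/-! ### The postprocessed function -/

/-- The symmetric part of φ e_i ⊗ e_j isolates one entry of a symmetric tensor. Its weak div div
comes from integrating by parts against the Hessian of another test function. -/
lemma exists_single_field (hΩ : IsOpen Ω) {φ : Sp d → ℝ} (h : IsTest Ω φ) (i j : Fin d) :
    ∃ N : L2S Ω, (∀ M : L2S Ω, inner ℝ M N = ∫ x in Ω, entry (M x) i j * φ x) ∧
      N ∈ HdivDiv Ω ∧ divDiv N = (h.pd_pd i j).toL2 := by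
  let a : Fin d → Fin d → Sp d → ℝ := fun k l => if k = i ∧ l = j then φ else 0
  have ha : ∀ k l, IsTest Ω (a k l) := by
    intro k l
    by_cases hkl : k = i ∧ l = j
    · simpa [a, hkl] using h
    · simpa [a, hkl] using isTest_zero
  have key : ∀ M : L2S Ω, inner ℝ M (toL2S ha) = ∫ x in Ω, entry (M x) i j * φ x := by
    intro M
    rw [inner_toL2S]
    congr 1
    funext x
    rw [Finset.sum_eq_single i (fun k _ hk => Finset.sum_eq_zero fun l _ => by simp [a, hk])
      (by simp), Finset.sum_eq_single j (fun l _ hl => by simp [a, hl]) (by simp)]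
    simp [a]
  have hw : HasWeakDivDiv (toL2S ha) (h.pd_pd i j).toL2 := by
    rw [hasWeakDivDiv_iff]
    intro ψ hψ
    rw [innerS_comm, key, ← hψ.hasWeakHess φ h i j, real_inner_comm, IsTest.inner_toL2]
  exact ⟨toL2S ha, key, ⟨_, hw⟩, hw.divDiv_eq hΩ⟩

/-- The variational equation divided by B, with its scalar terms gathered into u. Compared with
`trGgrad_eq`, it yields first the Hessian of u and then its boundary condition. -/
lemma IsSolution.inner_eq (hm : 0 < m) (hB : 0 < B) {Γ : BoundaryDecomposition Ω} {f g : L2 Ω}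
    {G M N : L2S Ω} (h : IsSolution m q B T Γ f G g M) (hN : N ∈ HNdivDiv Γ) :
    inner ℝ M N = inner ℝ (divDivT q T N) (postU m q B T f M) - trGgrad g N := by
  have h1 := h.2.1 N hN
  rw [innerDivDiv] at h1
  rw [postU, inner_sub_right, real_inner_smul_right, real_inner_smul_right,
    real_inner_comm f, real_inner_comm (divDivT q T M)]
  have h2 : B * inner ℝ M N = B * (1 / m * inner ℝ f (divDivT q T N)
      - B / m * inner ℝ (divDivT q T M) (divDivT q T N) - trGgrad g N) := by
    field_simp at h1 ⊢
    linarith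
  exact mul_left_cancel₀ hB.ne' h2

/-- The compactly supported field of `exists_single_field` has zero trace against all of H², so it
lies in H_N and the datum g drops out; what remains is the weak Hessian identity for one entry. -/
lemma IsSolution.hasWeakHess_postU (hΩ : IsOpen Ω) (hm : 0 < m) (hB : 0 < B)
    {Γ : BoundaryDecomposition Ω} {f g : L2 Ω} {G M : L2S Ω} (hg : g ∈ H2 Ω)
    (h : IsSolution m q B T Γ f G g M) :
    HasWeakHess (postU m q B T f M) (M - q ^ 2 • tmul T (postU m q B T f M)) := by
  intro φ hφ i j
  obtain ⟨N, hN, hNd, hdN⟩ := exists_single_field hΩ hφ i j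
  have htr : ∀ v ∈ H2 Ω, trGgrad v N = 0 := by
    intro v hv
    rw [trGgrad, hdN, innerS_comm, hN, ← hasWeakHess_hess hv.2 φ hφ i j, real_inner_comm,
      IsTest.inner_toL2, sub_self]
  have hHN : N ∈ HNdivDiv Γ := ⟨hNd, fun v hv => htr v hv.1⟩
  have h1 := h.inner_eq hm hB hHN
  rw [htr g hg, sub_zero, inner_divDivT, hdN, real_inner_comm, IsTest.inner_toL2] at h1
  rw [← hN, innerS_sub_left, innerS_smul_left, innerS_comm (tmul T _) N]
  linarith

lemma hessT_sub (hΩ : IsOpen Ω) {v w : L2 Ω} (hv : v ∈ H2 Ω) (hw : w ∈ H2 Ω) :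
    hessT q T (v - w) = hessT q T v - hessT q T w := by
  have e : v - w = v + (-1 : ℝ) • w := by module
  have hw' : HasWeakHess ((-1 : ℝ) • w) ((-1 : ℝ) • hess w) :=
    (hasWeakHess_hess hw.2).const_smul _
  simp only [hessT]
  rw [e, ((hasWeakHess_hess hv.2).add hw').hess_eq hΩ, tmul_add, tmul_smul]
  module

/-! ### Energy expansion and minimality. -/

lemma energy_eq (m q B : ℝ) (T : LinfS Ω) (f v : L2 Ω) (G : L2S Ω) :
    energy m q B T f G v = B / 2 * ‖hessT q T v‖ ^ 2 + m / 2 * ‖v‖ ^ 2 - inner ℝ f v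
      + B * trDivDiv G v := by
  have e1 : ∫ x in Ω, ‖(hess v + q ^ 2 • tmul T v) x‖ ^ 2 = ‖hessT q T v‖ ^ 2 := by
    rw [← innerS_self, L2.inner_def]
    exact integral_congr_ae (Eventually.of_forall fun x =>
      (real_inner_self_eq_norm_sq (hessT q T v x)).symm)
  have e2 : ∫ x in Ω, v x ^ 2 = ‖v‖ ^ 2 := by
    rw [← real_inner_self_eq_norm_sq, L2.inner_def]
    exact integral_congr_ae (Eventually.of_forall fun x => by simp [sq])
  have e3 : ∫ x in Ω, f x * v x = inner ℝ f v := by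
    rw [L2.inner_def]
    exact integral_congr_ae (Eventually.of_forall fun x => by simp [mul_comm])
  rw [energy, e1, e2, e3]

/-- The first-order term at u vanishes: m u = f - B(div div M + q² T:M), and v and u have equal
traces against M - G, which lies in H_N. Only the quadratic remainder is left. -/
lemma IsSolution.energy_eq (hΩ : IsOpen Ω) (hm : 0 < m) (hB : 0 < B)
    {Γ : BoundaryDecomposition Ω} {f g u v : L2 Ω} {G M : L2S Ω} (hG : G ∈ HdivDiv Ω)
    (h : IsSolution m q B T Γ f G g M) (hu : u = postU m q B T f M) (hMu : M = hessT q T u)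
    (huV : u ∈ Vg Γ g) (hv : v ∈ Vg Γ g) :
    energy m q B T f G v = energy m q B T f G u + B / 2 * ‖hessT q T (v - u)‖ ^ 2
      + m / 2 * ‖v - u‖ ^ 2 := by
  have hA := hessT_sub (q := q) (T := T) hΩ hv.1 huV.1
  have hMG : hat m q B T (M - G) ∈ hatHN m q B T Γ := by
    rw [hat_sub hΩ h.1 hG]
    exact ((isSolution_iff hΩ hm hB hG).1 h).2.1
  have hHN : M - G ∈ HNdivDiv Γ := (mem_HNdivDiv_iff hΩ hm hB).2 ⟨sub_mem_HdivDiv h.1 hG, hMG⟩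
  have htr : ∀ w, trGgrad w (M - G) = trGgrad w M - trGgrad w G := by
    intro w
    have h' := inner_hat_chk (q := q) (T := T) hm hB (M - G) w
    rw [hat_sub hΩ h.1 hG, inner_sub_left, inner_hat_chk hm hB, inner_hat_chk hm hB,
      ← mul_sub] at h'
    exact (mul_left_cancel₀ hB.ne' h').symm
  have hbc : trGgrad v (M - G) = trGgrad u (M - G) := (hv.2 _ hHN).trans (huV.2 _ hHN).symm
  rw [htr, htr, trGgrad_eq (q := q) (T := T) M v, trGgrad_eq (q := q) (T := T) M u] at hbc
  have hmu : m * inner ℝ u v - m * inner ℝ u u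
      = inner ℝ f v - inner ℝ f u - B * (inner ℝ (divDivT q T M) v
        - inner ℝ (divDivT q T M) u) := by
    have : ∀ w, m * inner ℝ u w = inner ℝ f w - B * inner ℝ (divDivT q T M) w := by
      intro w
      rw [hu, postU, inner_sub_left, real_inner_smul_left, real_inner_smul_left]
      field_simp
    rw [this, this]
    ring
  have n1 : ‖hessT q T (v - u)‖ ^ 2 = ‖hessT q T v‖ ^ 2 - 2 * inner ℝ (hessT q T u) (hessT q T v)
      + ‖hessT q T u‖ ^ 2 := by
    rw [hA, innerS_comm (hessT q T u)]
    exact norm_sub_sq_real (hessT q T v) (hessT q T u)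
  have n2 : ‖v - u‖ ^ 2 = ‖v‖ ^ 2 - 2 * inner ℝ u v + ‖u‖ ^ 2 := by
    rw [real_inner_comm v u]
    exact norm_sub_sq_real v u
  rw [Smectic.energy_eq, Smectic.energy_eq, n1, n2]
  have n3 : (inner ℝ M (hessT q T v) : ℝ) = inner ℝ (hessT q T u) (hessT q T v) := by rw [hMu]
  have n4 : (inner ℝ M (hessT q T u) : ℝ) = ‖hessT q T u‖ ^ 2 := by rw [hMu, innerS_self]
  rw [n3, n4] at hbc
  rw [real_inner_self_eq_norm_sq] at hmu
  change _ - trDivDiv G v = _ - trDivDiv G u at hbc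
  linear_combination hmu - B * hbc

theorem IsSolution.isArgmin (hΩ : IsOpen Ω) (hm : 0 < m) (hB : 0 < B)
    {Γ : BoundaryDecomposition Ω} {f g u : L2 Ω} {G M : L2S Ω} (hG : G ∈ HdivDiv Ω)
    (h : IsSolution m q B T Γ f G g M) (hu : u = postU m q B T f M) (hMu : M = hessT q T u)
    (huV : u ∈ Vg Γ g) : IsArgmin m q B T Γ f G g u := by
  refine ⟨huV, fun v hv => ?_, fun v hv hle => ?_⟩
  · rw [h.energy_eq hΩ hm hB hG hu hMu huV hv, add_assoc]
    exact le_add_of_nonneg_right (by positivity)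
  · rw [h.energy_eq hΩ hm hB hG hu hMu huV hv] at hle
    have h1 : 0 ≤ B / 2 * ‖hessT q T (v - u)‖ ^ 2 := by positivity
    have h2 : ‖v - u‖ ^ 2 ≤ 0 := by
      by_contra! hlt
      have : 0 < m / 2 * ‖v - u‖ ^ 2 := by positivity
      linarith
    exact sub_eq_zero.1 (norm_eq_zero.1 (pow_eq_zero_iff two_ne_zero |>.1
      (le_antisymm h2 (sq_nonneg _))))

/-! ### Norm bounds for u. -/

lemma norm_postU_le (hm : 0 < m) (hB : 0 < B) (f : L2 Ω) (M : L2S Ω) :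
    ‖postU m q B T f M‖ ≤ 1 / m * ‖f‖ + B / m * ‖divDivT q T M‖ := by
  refine (norm_sub_le _ _).trans_eq ?_
  rw [norm_smul, norm_smul, Real.norm_eq_abs, Real.norm_eq_abs, abs_of_pos (by positivity),
    abs_of_pos (by positivity)]

lemma norm_divDivT_le (hm : 0 < m) (hB : 0 < B) (M : L2S Ω) :
    B / m * ‖divDivT q T M‖ ≤ 1 / Real.sqrt m * normDivDiv m q B T M := by
  have hm' := Real.sqrt_pos.2 hm
  have h : B / Real.sqrt m * ‖divDivT q T M‖ ≤ normDivDiv m q B T M := by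
    rw [← norm_hat hm hB, hat, norm_mkPair]
    refine Real.le_sqrt_of_sq_le ?_
    rw [norm_smul _ (divDivT q T M), Real.norm_eq_abs,
      abs_of_pos (by positivity : 0 < B / Real.sqrt m)]
    exact le_add_of_nonneg_left (sq_nonneg _)
  calc B / m * ‖divDivT q T M‖ = 1 / Real.sqrt m * (B / Real.sqrt m * ‖divDivT q T M‖) := by
        rw [← mul_assoc, div_mul_div_comm, Real.mul_self_sqrt hm.le, one_mul]
    _ ≤ _ := by gcongr

/-- The formulas for u and M combine into `chk u` = (0, f/√m) - `hat M`; the triangle inequality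
finishes. -/
lemma normGgrad_postU_le (hm : 0 < m) (hB : 0 < B) {f u : L2 Ω} {M : L2S Ω}
    (hu : u = postU m q B T f M) (hMu : M = hessT q T u) :
    normGgrad m q B T u ≤ 1 / Real.sqrt m * ‖f‖ + normDivDiv m q B T M := by
  have hm' := Real.sqrt_pos.2 hm
  have e1 : Real.sqrt m * (1 / m) = 1 / Real.sqrt m := by
    field_simp
    rw [Real.sq_sqrt hm.le]
  have e2 : Real.sqrt m * (B / m) = B / Real.sqrt m := by
    field_simp
    rw [Real.sq_sqrt hm.le]
  have hc : chk m q B T u = mkPair 0 ((1 / Real.sqrt m) • f) + (-1 : ℝ) • hat m q B T M := by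
    rw [hat, ← mkPair_smul, ← mkPair_add, chk, ← hMu]
    congr 1
    · module
    · rw [hu, postU, smul_sub, smul_smul, smul_smul, e1, e2]
      module
  rw [← norm_chk hm hB, hc]
  refine (norm_add_le _ _).trans ?_
  rw [norm_smul, norm_hat hm hB, norm_mkPair_zero, norm_smul, Real.norm_eq_abs, Real.norm_eq_abs,
    abs_of_pos (by positivity : 0 < 1 / Real.sqrt m)]
  simp

end Problem

end

end Smectic

/-! ### Assembly of the theorem. -/

theorem theorem4p1 (d : ℕ) (hd : d = 2 ∨ d = 3) (Ω : Set (Sp d)) (hΩ : IsAdmissibleDomain Ω)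
    (Γ : BoundaryDecomposition Ω) (m q B : ℝ) (hm : 0 < m) (hq : 0 < q) (hB : 0 < B) (hB1 : B ≤ 1)
    (T : LinfS Ω) (f : L2 Ω) (G : L2S Ω) (hG : G ∈ HdivDiv Ω) (g : L2 Ω) (hg : g ∈ H2 Ω) :
    (∃! M : L2S Ω, IsSolution m q B T Γ f G g M) ∧
    ∀ M : L2S Ω, IsSolution m q B T Γ f G g M → ∀ u : L2 Ω, u = postU m q B T f M →
      normDivDiv m q B T M
          ≤ 1 / Real.sqrt m * ‖f‖ + 2 * normDivDiv m q B T G + normGgrad m q B T g ∧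
      u ∈ H2 Ω ∧
      M = hess u + q ^ 2 • tmul T u ∧
      BCu Γ g u ∧
      BCM Γ G (hess u + q ^ 2 • tmul T u) ∧
      IsArgmin m q B T Γ f G g u ∧
      normGgrad m q B T u
          ≤ 3 / Real.sqrt m * ‖f‖ + 3 * normDivDiv m q B T G + 2 * normGgrad m q B T g ∧
      ‖u‖ ≤ 1 / m * ‖f‖ + B / m * ‖divDivT q T M‖ ∧
      1 / m * ‖f‖ + B / m * ‖divDivT q T M‖
          ≤ 1 / m * ‖f‖ + 1 / Real.sqrt m * normDivDiv m q B T M := by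
  have hO := hΩ.isOpen
  refine ⟨existsUnique_isSolution hO hm hB Γ f g hG, fun M hM u hu => ?_⟩
  have hH : HasWeakHess u (M - q ^ 2 • tmul T u) := by
    rw [hu]
    exact hM.hasWeakHess_postU hO hm hB hg
  have huH2 : u ∈ H2 Ω := ⟨hH.exists_hasWeakGrad hO hΩ.bounded hΩ.lipschitz, _, hH⟩
  have hMu : M = hessT q T u := by
    rw [hessT, hH.hess_eq hO, sub_add_cancel]
  have hbc : BCu Γ g u := by
    intro N hN
    have h1 := hM.inner_eq hm hB hN
    rw [← hu, innerS_comm] at h1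
    rw [trGgrad_eq (q := q) (T := T) N u, ← hMu]
    linarith
  have hMle := hM.normDivDiv_le hO hm hB hG
  refine ⟨hMle, huH2, hMu, hbc, ?_, hM.isArgmin hO hm hB hG hu hMu ⟨huH2, hbc⟩, ?_, ?_, ?_⟩
  · change BCM Γ G (hessT q T u)
    rw [← hMu]
    exact hM.2.2
  -- Together with the bound on M this gives the constants 2, 2, 1; the claimed 3, 3, 2 follow
  -- because all terms are nonnegative.
  · have h1 := normGgrad_postU_le hm hB hu hMu
    have h2 : 0 ≤ normDivDiv m q B T G := Real.sqrt_nonneg _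
    have h3 : 0 ≤ normGgrad m q B T g := Real.sqrt_nonneg _
    have h4 : 0 ≤ 1 / Real.sqrt m * ‖f‖ := by positivity
    have h5 : 3 / Real.sqrt m * ‖f‖ = 3 * (1 / Real.sqrt m * ‖f‖) := by ring
    rw [h5]
    linarith
  · rw [hu]
    exact norm_postU_le hm hB f M
  · exact add_le_add_right (norm_divDivT_le hm hB M) _
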